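/- Let $1<p<\infty$, let $(X,d)$ be a complete metric space, and let $\mu$ be (the completion of) a Borel measure on $X$ with $0<\mu(B)<\infty$ for all balls $B$. Assume that $\mu$ is doubling, i.e. there is a constant $C_\mu$ with $\mu(2B)\le C_\mu\,\mu(B)$ for all balls $B$, and that $X$ supports a $p$-Poincaré inequality: there are $C>0$, $\lambda\ge 1$ such that $$\frac1{\mu(B)}\int_B|u-u_B|\,d\mu\le C\,\mathrm{diam}(B)\Bigl(\frac1{\mu(\lambda B)}\int_{\lambda B}g^p\,d\mu\Bigr)^{1/p},\qquad u_B:=\frac1{\mu(B)}\int_Bu\,d\mu,$$ for all balls $B$, all integrable $u$ on $X$ and all upper gradients $g$ of $u$. Here a Borel function $g\colon Y\to[0,\infty]$ on a metric space $Y$ is an upper gradient of $u\colon Y\to[-\infty,\infty]$ if $|u(x)-u(y)|\le\int_\gamma g\,ds$ for all nonconstant rectifiable curves $\gamma$ in $Y$ joining $x$ and $y$, where the left-hand side is read as $\infty$ if $u(x)$ or $u(y)$ is infinite. For an open set $Y\subset X$ (with the restrictions of $d$ and $\mu$), $D^p(Y)$ is the set of all everywhere defined measurable functions $u\colon Y\to[-\infty,\infty]$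 that have an upper gradient in $L^p(Y)$, and $N^{1,p}(Y)$ is the set of all everywhere defined measurable functions $u\colon Y\to[-\infty,\infty]$ for which $$\|u\|_{N^{1,p}(Y)}:=\Bigl(\int_Y|u|^p\,d\mu+\inf_g\int_Yg^p\,d\mu\Bigr)^{1/p}<\infty,$$ the infimum being over all upper gradients $g$ of $u$. The Sobolev capacity of $E\subset X$ is $C_p(E):=\inf\|u\|_{N^{1,p}(X)}^p$ over all $u\in N^{1,p}(X)$ with $u\ge1$ on $E$ (with $\inf\varnothing=\infty$). Let $\Omega\subset X$ be a nonempty (possibly unbounded) open set with $C_p(X\setminus\Omega)>0$. Closures and boundaries are taken in $X$. Let $$D^p_0(\Omega):=\{u|_\Omega: u\in D^p(X)\text{ and }u=0\text{ in }X\setminus\Omega\}.$$ For $E\subset\overline\Omega$ let $\overline C_p(E;\Omega):=\inf\|u\|_{N^{1,p}(\Omega)}^p$, where the infimum is over all $u\in N^{1,p}(\Omega)$ such that $u\ge 1$ on $E\cap\Omega$ and $\liminf_{\Omega\ni y\to x}u(y)\ge1$ for all $x\in E\cap\partial\Omega$. A function $f\colon\overline\Omega\to[-\infty,\infty]$ is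 $\overline C_p(\cdot\,;\Omega)$-quasicontinuous on $\overline\Omega$ if for every $\varepsilon>0$ there is a relatively open $U\subset\overline\Omega$ with $\overline C_p(U;\Omega)<\varepsilon$ such that $f|_{\overline\Omega\setminus U}$ is continuous and real-valued. **Proposition.** Let $f\colon\overline\Omega\to[-\infty,\infty]$ be such that $f|_\Omega\in D^p_0(\Omega)$ and $f=0$ on $\partial\Omega$ except possibly on a set of $\overline C_p(\cdot\,;\Omega)$-capacity zero. Then $f$ is $\overline C_p(\cdot\,;\Omega)$-quasicontinuous on $\overline\Omega$. -/

import Mathlib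

open MeasureTheory Filter Topology Set
open scoped ENNReal NNReal

namespace MetricPotential

/-- The line integral `∫_γ g ds` over a curve of length `l` that is parametrized by arc length
on `[0, l]`. -/
noncomputable def lineIntegral {X : Type*} (g : X → ℝ≥0∞) (γ : ℝ → X) (l : ℝ) : ℝ≥0∞ :=
  ∫⁻ t in Icc 0 l, g (γ t)

/-- `g` is an upper gradient of `f`: `g` is a Borel function with values in `[0, ∞]` and
`|f x - f y| ≤ ∫_γ g ds` for every nonconstant rectifiable curve `γ` joining `x` and `y`.
A nonconstant rectifiable curve is given by its arc length parametrization `γ : [0, l] → X`,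
`0 < l`, i.e. the length of `γ` on `[s, t]` is `t - s`.
In `EReal`, `(a - b).abs = ⊤` as soon as `a` or `b` is infinite (also for `⊤ - ⊤` and `⊥ - ⊥`),
which is the usual convention for upper gradients. -/
def IsUpperGradient {X : Type*} [MetricSpace X] [MeasurableSpace X]
    (f : X → EReal) (g : X → ℝ≥0∞) : Prop :=
  Measurable g ∧
    ∀ (l : ℝ) (γ : ℝ → X), 0 < l → HasUnitSpeedOn γ (Icc 0 l) →
      (f (γ 0) - f (γ l)).abs ≤ lineIntegral g γ l

/-- The seminorm `(∫ |u|^p dμ + inf_g ∫ g^p dμ)^(1/p)`, where `g` runs through all upper gradients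
of `u`. -/
noncomputable def newtonianSeminorm {X : Type*} [MetricSpace X] [MeasurableSpace X]
    (p : ℝ) (μ : Measure X) (u : X → EReal) : ℝ≥0∞ :=
  (∫⁻ x, (u x).abs ^ p ∂μ + ⨅ (g : X → ℝ≥0∞) (_ : IsUpperGradient u g), ∫⁻ x, g x ^ p ∂μ) ^ (1 / p)

/-- The Newtonian space `N^{1,p}(X)` of everywhere defined, extended real-valued functions.
Measurability is with respect to the completion of the Borel `σ`-algebra, which is what
`AEMeasurable` says. -/
def MemNewtonian {X : Type*} [MetricSpace X] [MeasurableSpace X]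
    (p : ℝ) (μ : Measure X) (u : X → EReal) : Prop :=
  AEMeasurable u μ ∧ newtonianSeminorm p μ u < ⊤

/-- The Dirichlet space `D^p(X)`: everywhere defined, extended real-valued, measurable functions
that have an upper gradient in `L^p(X)`. -/
def MemDirichlet {X : Type*} [MetricSpace X] [MeasurableSpace X]
    (p : ℝ) (μ : Measure X) (u : X → EReal) : Prop :=
  AEMeasurable u μ ∧ ∃ g : X → ℝ≥0∞, IsUpperGradient u g ∧ ∫⁻ x, g x ^ p ∂μ < ⊤

/-- The Dirichlet space `D^p_0(E)` with zero boundary values: restrictions to `E` of functions in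
`D^p(X)` that vanish (everywhere) outside `E`. -/
def MemDirichletZero {X : Type*} [MetricSpace X] [MeasurableSpace X]
    (p : ℝ) (μ : Measure X) (E : Set X) (h : E → EReal) : Prop :=
  ∃ u : X → EReal, MemDirichlet p μ u ∧ (∀ x, x ∉ E → u x = 0) ∧ ∀ x : E, h x = u x

/-- The Sobolev capacity `C_p(E)` (with respect to the whole space);
it is `⊤` if there are no admissible functions. -/
noncomputable def sobolevCapacity {X : Type*} [MetricSpace X] [MeasurableSpace X]
    (p : ℝ) (μ : Measure X) (E : Set X) : ℝ≥0∞ :=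
  ⨅ (u : X → EReal) (_ : MemNewtonian p μ u ∧ ∀ x ∈ E, 1 ≤ u x), newtonianSeminorm p μ u ^ p

/-- The capacity `C̄_p(E; Ω)` of a set `E ⊆ closure Ω`. The space `N^{1,p}(Ω)` is the Newtonian
space of the metric space `Ω` with the restriction of the measure `μ`; the admissible functions
`u ∈ N^{1,p}(Ω)` satisfy `u ≥ 1` on `E ∩ Ω`, and `liminf u(y) ≥ 1` as `Ω ∋ y → x` for
`x ∈ E ∩ ∂Ω`. -/
noncomputable def smallCapacity {X : Type*} [MetricSpace X] [MeasurableSpace X]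
    (p : ℝ) (μ : Measure X) (Ω : Set X) (E : Set X) : ℝ≥0∞ :=
  ⨅ (u : Ω → EReal) (_ : MemNewtonian p (μ.comap ((↑) : Ω → X)) u ∧
      (∀ x : Ω, (x : X) ∈ E → 1 ≤ u x) ∧
      ∀ x ∈ E ∩ frontier Ω, 1 ≤ liminf u (comap ((↑) : Ω → X) (𝓝 x))),
    newtonianSeminorm p (μ.comap ((↑) : Ω → X)) u ^ p

/-- `C̄_p(·; Ω)`-quasicontinuity of an extended real-valued function on the closure of `Ω` in `X`:
outside relatively open sets of arbitrarily small capacity the restriction of `f` is continuous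
and real-valued. -/
def IsSmallQuasicontinuous {X : Type*} [MetricSpace X] [MeasurableSpace X]
    (p : ℝ) (μ : Measure X) (Ω : Set X) (f : closure Ω → EReal) : Prop :=
  ∀ ε : ℝ≥0∞, 0 < ε → ∃ U : Set (closure Ω), IsOpen U ∧
    smallCapacity p μ Ω ((↑) '' U) < ε ∧
    ContinuousOn f Uᶜ ∧ ∀ x ∈ Uᶜ, f x ≠ ⊤ ∧ f x ≠ ⊥

/-- All balls have positive and finite measure, and `μ(2B) ≤ C μ(B)` for all balls `B`. -/
def IsDoubling {X : Type*} [MetricSpace X] [MeasurableSpace X] (μ : Measure X) : Prop :=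
  (∀ (x : X) (r : ℝ), 0 < r → 0 < μ (Metric.ball x r) ∧ μ (Metric.ball x r) < ⊤) ∧
    ∃ C : ℝ≥0, ∀ (x : X) (r : ℝ), 0 < r → μ (Metric.ball x (2 * r)) ≤ C * μ (Metric.ball x r)

/-- The `p`-Poincaré inequality (that is, the `(1,p)`-Poincaré inequality): for all balls `B`,
all integrable functions `u` on `X` and all upper gradients `g` of `u`, the mean of `|u - u_B|`
over `B` is at most `C diam(B)` times the `L^p`-mean of `g` over `λB`. -/
def SupportsPoincare {X : Type*} [MetricSpace X] [MeasurableSpace X]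
    (p : ℝ) (μ : Measure X) : Prop :=
  ∃ (C lam : ℝ), 0 < C ∧ 1 ≤ lam ∧
    ∀ (x : X) (r : ℝ), 0 < r → ∀ u : X → ℝ, Integrable u μ →
      ∀ g : X → ℝ≥0∞, IsUpperGradient (fun y => (u y : EReal)) g →
        ⨍⁻ y in Metric.ball x r, ‖u y - ⨍ z in Metric.ball x r, u z ∂μ‖ₑ ∂μ ≤
          ENNReal.ofReal (C * Metric.diam (Metric.ball x r)) *
            (⨍⁻ y in Metric.ball x (lam * r), g y ^ p ∂μ) ^ (1 / p)

end MetricPotential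

/-! The zero extension `u` of `f` restricted to `Ω` is a Dirichlet function on all of `X`. The main
work is to show that `u` is quasicontinuous on `X` for the Sobolev capacity; the result on `closure
Ω` then follows by restriction.

Approximation. By the Poincaré inequality and doubling, a bounded integrable `w` with upper gradient
`g` in `L^p` is Lipschitz with constant of order `n` on its Lebesgue points off the set where a
restricted maximal function of `g^p` exceeds `n^p`. That set has measure `o(n^{-p})`, so McShane
extensions approximate `w` in the Newtonian norm (`exists_continuous_approx`). Fast approximants
converge uniformly off an open set of small capacity, and it remains to see that they converge to
`w` itself.

Exceptional sets. The set where convergence to `w` fails is null, and every nonconstant curve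
starting there has infinite length for one weight in `L^p`. Such a set has open neighbourhoods of
small capacity (`exists_isOpen_sobolevCapacity_le`): for a lower semicontinuous weight `ρ` supported
near the set, the least cost of running from `x` for unit time is lower semicontinuous in `x`, at
least `1` on the set, and its truncation at `1` has `ρ` as upper gradient.

General `u`. Arctangent and cutoffs reduce to the bounded integrable case
(`exists_isOpen_continuousOn`) once `u` is finite almost everywhere. If it were not, Poincaré would
give `|u| = ∞` almost everywhere; the finite set of `u`, which contains `Ωᶜ`, would then have zero
capacity (`measure_abs_eq_top`), against the assumption on `Ωᶜ`.

Transfer. Functions admissible for an open `G` restrict to `Ω` and remain admissible there. A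
function admissible for the exceptional boundary set exceeds `1/2` in `Ω` near that set, so its
double serves a whole neighbourhood (`exists_isOpen_smallCapacity_lt`). Off the union of both
neighbourhoods `f` coincides with `u`. -/

namespace MetricPotential

/-! ### Arc length parametrized curves and their subcurves. -/

section Curves

variable {X : Type*} [MetricSpace X]

lemma lipschitzOnWith_of_hasUnitSpeedOn {γ : ℝ → X} {l : ℝ}
    (h : HasUnitSpeedOn γ (Icc 0 l)) : LipschitzOnWith 1 γ (Icc 0 l) := by
  have key : ∀ x ∈ Icc 0 l, ∀ y ∈ Icc 0 l, x ≤ y → edist (γ x) (γ y) ≤ edist x y := by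
    intro x hx y hy hxy
    have h1 := h hx hy
    have h2 : edist (γ x) (γ y) ≤ eVariationOn γ (Icc 0 l ∩ Icc x y) :=
      eVariationOn.edist_le γ ⟨hx, le_rfl, hxy⟩ ⟨hy, hxy, le_rfl⟩
    rw [h1] at h2
    rw [edist_comm x y, edist_dist y x, Real.dist_eq, abs_of_nonneg (sub_nonneg.2 hxy)]
    simpa using h2
  intro x hx y hy
  rw [ENNReal.coe_one, one_mul]
  rcases le_total x y with hxy | hxy
  · exact key x hx y hy hxy
  · rw [edist_comm, edist_comm x y]
    exact key y hy x hx hxy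

lemma hasUnitSpeedOn_shift {γ : ℝ → X} {l a b : ℝ} (h : HasUnitSpeedOn γ (Icc 0 l))
    (ha : 0 ≤ a) (hb : b ≤ l) : HasUnitSpeedOn (fun t => γ (a + t)) (Icc 0 (b - a)) := by
  intro x hx y hy
  have h1 := h (x := a + x) ⟨by linarith [hx.1], by linarith [hx.2]⟩ (y := a + y)
    ⟨by linarith [hy.1], by linarith [hy.2]⟩
  have h2 : (fun t => γ (a + t)) = γ ∘ (fun t => a + t) := rfl
  rw [h2, eVariationOn.comp_eq_of_monotoneOn γ (fun t => a + t)
    (fun s _ t _ hst => by simpa using hst)]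
  have h3 : (fun t => a + t) '' (Icc 0 (b - a) ∩ Icc x y) = Icc 0 l ∩ Icc (a + x) (a + y) := by
    ext t
    constructor
    · rintro ⟨s, ⟨hs1, hs2⟩, rfl⟩
      exact ⟨⟨by linarith [hs1.1], by linarith [hs1.2]⟩, by linarith [hs2.1], by linarith [hs2.2]⟩
    · rintro ⟨ht1, ht2⟩
      exact ⟨t - a, ⟨⟨by linarith [ht2.1, hx.1], by linarith [ht2.2, hy.2]⟩,
        by linarith [ht2.1], by linarith [ht2.2]⟩, by ring⟩
  rw [h3, h1]
  congr 2
  ring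

lemma lintegral_Icc_shift (F : ℝ → ℝ≥0∞) (a b : ℝ) :
    ∫⁻ t in Icc 0 (b - a), F (a + t) = ∫⁻ t in Icc a b, F t := by
  have h := (measurePreserving_add_left (volume : Measure ℝ) a).setLIntegral_comp_preimage_emb
    (measurableEmbedding_addLeft a) F (Icc a b)
  rw [← h]
  congr 2
  simp

end Curves

/-! ### Calculus of upper gradients along curves. -/

section UpperGradients

variable {X : Type*} [MetricSpace X] [MeasurableSpace X]

lemma abs_coe_sub_coe (a b : ℝ) : ((a : EReal) - b).abs = edist a b := by
  rw [← EReal.coe_sub, EReal.abs_def, edist_dist, Real.dist_eq]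

lemma abs_coe_eq_enorm (a : ℝ) : (a : EReal).abs = ‖a‖ₑ := by
  rw [EReal.abs_def, Real.enorm_eq_ofReal_abs]

lemma isUpperGradient_coe_iff {v : X → ℝ} {g : X → ℝ≥0∞} :
    IsUpperGradient (fun x => (v x : EReal)) g ↔ Measurable g ∧
      ∀ (l : ℝ) (γ : ℝ → X), 0 < l → HasUnitSpeedOn γ (Icc 0 l) →
        edist (v (γ 0)) (v (γ l)) ≤ lineIntegral g γ l := by
  simp only [IsUpperGradient, abs_coe_sub_coe]

/-- The Lipschitz bound is measured by `(a - b).abs`, which is `⊤` at infinite values, so `φ` may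
send `±∞` to any real number. -/
lemma IsUpperGradient.comp {u : X → EReal} {g : X → ℝ≥0∞} (h : IsUpperGradient u g)
    {φ : EReal → ℝ} {K : ℝ≥0} (hφ : ∀ a b, edist (φ a) (φ b) ≤ K * (a - b).abs) :
    IsUpperGradient (fun x => (φ (u x) : EReal)) (fun x => K * g x) := by
  refine isUpperGradient_coe_iff.2 ⟨h.1.const_mul _, fun l γ hl hγ => ?_⟩
  refine (hφ _ _).trans ?_
  rw [lineIntegral, lintegral_const_mul' _ _ ENNReal.coe_ne_top]
  gcongr
  exact h.2 l γ hl hγ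

lemma IsUpperGradient.mono {u : X → EReal} {g g' : X → ℝ≥0∞} (h : IsUpperGradient u g)
    (hg' : Measurable g') (hle : g ≤ g') : IsUpperGradient u g' :=
  ⟨hg', fun l γ hl hγ => (h.2 l γ hl hγ).trans (lintegral_mono fun t => hle (γ t))⟩

/-- Strictness of `a < b` matters: for `a = b` and an infinite value the left side is `⊤` while the
integral is `0`. -/
lemma IsUpperGradient.abs_sub_le {u : X → EReal} {g : X → ℝ≥0∞} (h : IsUpperGradient u g)
    {γ : ℝ → X} {l a b : ℝ} (hγ : HasUnitSpeedOn γ (Icc 0 l)) (ha : 0 ≤ a) (hab : a < b)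
    (hb : b ≤ l) : (u (γ a) - u (γ b)).abs ≤ ∫⁻ t in Icc a b, g (γ t) := by
  have h1 := h.2 (b - a) _ (sub_pos.2 hab) (hasUnitSpeedOn_shift hγ ha hb)
  rw [lineIntegral, lintegral_Icc_shift (fun t => g (γ t))] at h1
  simpa using h1

lemma IsUpperGradient.edist_le {v : X → ℝ} {g : X → ℝ≥0∞}
    (h : IsUpperGradient (fun x => (v x : EReal)) g)
    {γ : ℝ → X} {l a b : ℝ} (hγ : HasUnitSpeedOn γ (Icc 0 l)) (ha : 0 ≤ a) (hab : a ≤ b)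
    (hb : b ≤ l) : edist (v (γ a)) (v (γ b)) ≤ ∫⁻ t in Icc a b, g (γ t) := by
  rcases hab.eq_or_lt with rfl | hab
  · simp
  · rw [← abs_coe_sub_coe]
    exact h.abs_sub_le hγ ha hab hb

lemma aemeasurable_comp_curve [BorelSpace X] {γ : ℝ → X} {l : ℝ}
    (hγ : HasUnitSpeedOn γ (Icc 0 l)) : AEMeasurable γ (volume.restrict (Icc 0 l)) :=
  (lipschitzOnWith_of_hasUnitSpeedOn hγ).continuousOn.aemeasurable measurableSet_Icc

/-- If `γ` has finite `∞ · 1_N`-length, then almost every point of `γ` lies off `N`. -/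
lemma ae_notMem_of_lineIntegral_ne_top [BorelSpace X] {γ : ℝ → X} {l : ℝ}
    (hγ : HasUnitSpeedOn γ (Icc 0 l)) {N : Set X} {g : X → ℝ≥0∞}
    (hg : Measurable g) (hgN : ∀ x ∈ N, g x = ⊤) (h : lineIntegral g γ l ≠ ⊤) :
    ∀ᵐ t ∂(volume.restrict (Icc 0 l)), γ t ∉ N := by
  have h1 : AEMeasurable (fun t => g (γ t)) (volume.restrict (Icc 0 l)) :=
    hg.comp_aemeasurable (aemeasurable_comp_curve hγ)
  filter_upwards [ae_lt_top' h1 h] with t ht hmem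
  exact ht.ne (hgN _ hmem)

lemma edist_iSup_le {ι : Type*} [Nonempty ι] {a b : ι → ℝ} {M : ℝ≥0∞}
    (ha : BddAbove (range a)) (hb : BddAbove (range b)) (h : ∀ n, edist (a n) (b n) ≤ M) :
    edist (⨆ n, a n) (⨆ n, b n) ≤ M := by
  rcases eq_or_ne M ⊤ with rfl | hM
  · exact le_top
  lift M to ℝ≥0 using hM
  have h' : ∀ n, |a n - b n| ≤ M := fun n => by
    have := h n
    rw [edist_nndist, ENNReal.coe_le_coe, ← NNReal.coe_le_coe, coe_nndist, Real.dist_eq] at this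
    exact this
  rw [edist_nndist, ENNReal.coe_le_coe, ← NNReal.coe_le_coe, coe_nndist, Real.dist_eq, abs_le]
  constructor
  · have : (⨆ n, b n) ≤ (⨆ n, a n) + M :=
      ciSup_le fun n => by linarith [(abs_le.1 (h' n)).1, le_ciSup ha n]
    linarith
  · have : (⨆ n, a n) ≤ (⨆ n, b n) + M :=
      ciSup_le fun n => by linarith [(abs_le.1 (h' n)).2, le_ciSup hb n]
    linarith

lemma isUpperGradient_iSup {ι : Type*} [Countable ι] [Nonempty ι] {v : ι → X → ℝ}
    {g : ι → X → ℝ≥0∞} (h : ∀ n, IsUpperGradient (fun x => (v n x : EReal)) (g n))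
    (hb : ∀ x, BddAbove (range fun n => v n x)) :
    IsUpperGradient (fun x => ((⨆ n, v n x : ℝ) : EReal)) (fun x => ⨆ n, g n x) := by
  refine isUpperGradient_coe_iff.2 ⟨Measurable.iSup fun n => (h n).1, fun l γ hl hγ => ?_⟩
  refine edist_iSup_le (hb _) (hb _) fun n => ?_
  exact ((isUpperGradient_coe_iff.1 (h n)).2 l γ hl hγ).trans
    (lintegral_mono fun t => le_iSup (fun n => g n (γ t)) n)

end UpperGradients

/-! ### Truncations and countable subadditivity of the Sobolev capacity. -/

section Capacity

variable {X : Type*} [MetricSpace X] [MeasurableSpace X] {μ : Measure X} {p : ℝ}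

/-- The source of countable subadditivity: a supremum of functions and of their gradients is
dominated in `L^p` by the sum. -/
lemma iSup_rpow_le_tsum {ι : Type*} (hp : 0 < p) (a : ι → ℝ≥0∞) : (⨆ n, a n) ^ p ≤ ∑' n, a n ^ p := by
  rw [← ENNReal.le_rpow_inv_iff hp]
  refine iSup_le fun n => ?_
  rw [ENNReal.le_rpow_inv_iff hp]
  exact ENNReal.le_tsum n

lemma newtonianSeminorm_rpow (hp : 0 < p) (u : X → EReal) :
    newtonianSeminorm p μ u ^ p = ∫⁻ x, (u x).abs ^ p ∂μ +
      ⨅ (g : X → ℝ≥0∞) (_ : IsUpperGradient u g), ∫⁻ x, g x ^ p ∂μ := by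
  rw [newtonianSeminorm, one_div, ENNReal.rpow_inv_rpow hp.ne']

lemma newtonianSeminorm_rpow_le (hp : 0 < p) {v : X → ℝ} {g : X → ℝ≥0∞}
    (h : IsUpperGradient (fun x => (v x : EReal)) g) :
    newtonianSeminorm p μ (fun x => (v x : EReal)) ^ p ≤ ∫⁻ x, ‖v x‖ₑ ^ p ∂μ + ∫⁻ x, g x ^ p ∂μ := by
  rw [newtonianSeminorm_rpow hp]
  simp only [abs_coe_eq_enorm]
  gcongr
  exact iInf₂_le g h

lemma memNewtonian_coe (hp : 0 < p) {v : X → ℝ} {g : X → ℝ≥0∞} (hv : AEMeasurable v μ)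
    (h : IsUpperGradient (fun x => (v x : EReal)) g)
    (hlt : ∫⁻ x, ‖v x‖ₑ ^ p ∂μ + ∫⁻ x, g x ^ p ∂μ < ⊤) :
    MemNewtonian p μ (fun x => (v x : EReal)) := by
  refine ⟨measurable_coe_real_ereal.comp_aemeasurable hv, ?_⟩
  rw [← ENNReal.rpow_lt_top_iff_of_pos hp]
  exact (newtonianSeminorm_rpow_le hp h).trans_lt hlt

lemma sobolevCapacity_le (hp : 0 < p) {E : Set X} {v : X → ℝ} {g : X → ℝ≥0∞}
    (hv : AEMeasurable v μ) (h : IsUpperGradient (fun x => (v x : EReal)) g)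
    (hE : ∀ x ∈ E, 1 ≤ v x) :
    sobolevCapacity p μ E ≤ ∫⁻ x, ‖v x‖ₑ ^ p ∂μ + ∫⁻ x, g x ^ p ∂μ := by
  rcases eq_or_ne (∫⁻ x, ‖v x‖ₑ ^ p ∂μ + ∫⁻ x, g x ^ p ∂μ) ⊤ with htop | htop
  · rw [htop]; exact le_top
  · refine (iInf₂_le (fun x => (v x : EReal)) ⟨memNewtonian_coe hp hv h htop.lt_top, ?_⟩).trans
      (newtonianSeminorm_rpow_le hp h)
    intro x hx
    exact EReal.coe_le_coe_iff.2 (hE x hx)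

/-- The truncation `min 1 (K |a|)` of an extended real number, as a real number. -/
noncomputable def truncAbs (K : ℝ≥0) (a : EReal) : ℝ := (min 1 (K * a.abs)).toReal

lemma truncAbs_coe (K : ℝ≥0) (a : ℝ) : truncAbs K a = min 1 (K * |a|) := by
  rw [truncAbs, ENNReal.toReal_min (by simp)
    (ENNReal.mul_ne_top ENNReal.coe_ne_top (EReal.abs_coe_lt_top a).ne), ENNReal.toReal_mul,
    EReal.abs_def, ENNReal.toReal_ofReal (abs_nonneg a)]
  simp

lemma truncAbs_mem (K : ℝ≥0) (a : EReal) : truncAbs K a ∈ Icc (0 : ℝ) 1 :=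
  ⟨ENNReal.toReal_nonneg, ENNReal.toReal_mono (by simp) (min_le_left _ _)⟩

lemma ofReal_truncAbs (K : ℝ≥0) (a : EReal) : ‖truncAbs K a‖ₑ = min 1 (K * a.abs) := by
  rw [Real.enorm_of_nonneg (truncAbs_mem K a).1, truncAbs, ENNReal.ofReal_toReal]
  exact ((min_le_left _ _).trans_lt (by simp)).ne

lemma truncAbs_eq_one {K : ℝ≥0} {a : EReal} (h : 1 ≤ K * a.abs) : truncAbs K a = 1 := by
  rw [truncAbs, min_eq_left h]; simp

lemma edist_truncAbs_le {K : ℝ≥0} (hK : K ≠ 0) (a b : EReal) :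
    edist (truncAbs K a) (truncAbs K b) ≤ K * (a - b).abs := by
  have hK' : (K : ℝ≥0∞) * ⊤ = ⊤ := ENNReal.mul_top (by simpa using hK)
  induction a with
  | bot => induction b <;> simp [hK']
  | top => induction b <;> simp [hK']
  | coe a =>
    induction b with
    | bot => simp [hK']
    | top => simp [hK']
    | coe b =>
      rw [truncAbs_coe, truncAbs_coe, abs_coe_sub_coe, edist_nndist, edist_nndist,
        ← ENNReal.coe_mul, ENNReal.coe_le_coe, ← NNReal.coe_le_coe, NNReal.coe_mul, coe_nndist,
        coe_nndist, Real.dist_eq, Real.dist_eq]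
      calc |min 1 ((K : ℝ) * |a|) - min 1 (K * |b|)| ≤ |(K * |a| - K * |b| : ℝ)| := by
            refine (abs_min_sub_min_le_max _ _ _ _).trans ?_
            simp
        _ = K * abs (|a| - |b|) := by rw [← mul_sub, abs_mul, abs_of_nonneg K.coe_nonneg]
        _ ≤ K * |a - b| := mul_le_mul_of_nonneg_left (abs_abs_sub_abs_le_abs_sub a b) K.2

lemma measurable_ereal_abs : Measurable EReal.abs := by
  refine EReal.measurable_of_measurable_real ?_
  simp only [EReal.abs_def]
  fun_prop

lemma measurable_truncAbs (K : ℝ≥0) : Measurable (truncAbs K) :=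
  (measurable_const.min (measurable_ereal_abs.const_mul _)).ennreal_toReal

/-- Used with `K = 1` to make admissible functions real with values in `[0, 1]`, and with `K = 2` to
lift the level `1/2` to `1`. The strict bound leaves room to choose a gradient near the infimum. -/
lemma MemNewtonian.exists_truncAbs (hp : 0 < p) {u : X → EReal} (h : MemNewtonian p μ u)
    {c : ℝ≥0∞} (hc : newtonianSeminorm p μ u ^ p < c) {K : ℝ≥0} (hK : K ≠ 0) :
    AEMeasurable (fun x => truncAbs K (u x)) μ ∧ ∃ g : X → ℝ≥0∞,
      IsUpperGradient (fun x => (truncAbs K (u x) : EReal)) g ∧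
      ∫⁻ x, ‖truncAbs K (u x)‖ₑ ^ p ∂μ + ∫⁻ x, g x ^ p ∂μ < K ^ p * c := by
  refine ⟨(measurable_truncAbs K).comp_aemeasurable h.1, ?_⟩
  rw [newtonianSeminorm_rpow hp] at hc
  have hfin : ∫⁻ x, (u x).abs ^ p ∂μ ≠ ⊤ := (le_self_add.trans_lt hc).ne_top
  obtain ⟨g, hg, hlt⟩ : ∃ g : X → ℝ≥0∞, IsUpperGradient u g ∧
      ∫⁻ x, (u x).abs ^ p ∂μ + ∫⁻ x, g x ^ p ∂μ < c := by
    have h1 := lt_tsub_iff_left.2 hc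
    simp only [iInf_lt_iff] at h1
    obtain ⟨g, hg, hlt⟩ := h1
    exact ⟨g, hg, lt_tsub_iff_left.1 hlt⟩
  have hK0 : (K : ℝ≥0∞) ^ p ≠ 0 := by simp [hK, ENNReal.rpow_eq_zero_iff, hp]
  have hKt : (K : ℝ≥0∞) ^ p ≠ ⊤ := (ENNReal.rpow_lt_top_of_nonneg hp.le ENNReal.coe_ne_top).ne
  refine ⟨_, hg.comp (edist_truncAbs_le hK), ?_⟩
  refine lt_of_le_of_lt ?_ (ENNReal.mul_lt_mul_right hK0 hKt hlt)
  rw [mul_add, ← lintegral_const_mul' _ _ hKt, ← lintegral_const_mul' _ _ hKt]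
  simp only [ENNReal.mul_rpow_of_nonneg _ _ hp.le]
  gcongr with x
  rw [ofReal_truncAbs, ← ENNReal.mul_rpow_of_nonneg _ _ hp.le]
  gcongr
  exact min_le_right _ _

lemma exists_of_sobolevCapacity_lt (hp : 0 < p) {E : Set X} {c : ℝ≥0∞}
    (h : sobolevCapacity p μ E < c) : ∃ (v : X → ℝ) (g : X → ℝ≥0∞), AEMeasurable v μ ∧
      (∀ x, v x ∈ Icc (0 : ℝ) 1) ∧ (∀ x ∈ E, v x = 1) ∧
      IsUpperGradient (fun x => (v x : EReal)) g ∧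
      ∫⁻ x, ‖v x‖ₑ ^ p ∂μ + ∫⁻ x, g x ^ p ∂μ < c := by
  simp only [sobolevCapacity, iInf_lt_iff] at h
  obtain ⟨u, ⟨hu, hE⟩, hlt⟩ := h
  obtain ⟨hm, g, hg, hgc⟩ := hu.exists_truncAbs hp hlt one_ne_zero
  refine ⟨_, g, hm, fun x => truncAbs_mem 1 (u x), fun x hx => truncAbs_eq_one ?_, hg,
    by simpa using hgc⟩
  have := hE x hx
  rw [ENNReal.coe_one, one_mul]
  rw [← EReal.coe_ennreal_le_coe_ennreal_iff]
  refine le_trans (by simpa using this) ?_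
  generalize u x = a
  induction a with
  | bot => simp
  | top => simp
  | coe a => rw [EReal.coe_abs]; exact_mod_cast le_abs_self a

lemma sobolevCapacity_mono {E F : Set X} (h : E ⊆ F) :
    sobolevCapacity p μ E ≤ sobolevCapacity p μ F :=
  iInf_mono fun _ => iInf_mono' fun hv => ⟨⟨hv.1, fun x hx => hv.2 x (h hx)⟩, le_rfl⟩

lemma exists_iSup_bound {ι : Type*} [Countable ι] [Nonempty ι] (hp : 0 < p) {v : ι → X → ℝ}
    {g : ι → X → ℝ≥0∞}
    (hv : ∀ n, AEMeasurable (v n) μ) (hv1 : ∀ n x, v n x ∈ Icc (0 : ℝ) 1)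
    (hg : ∀ n, IsUpperGradient (fun x => (v n x : EReal)) (g n)) :
    AEMeasurable (fun x => ⨆ n, v n x) μ ∧
    IsUpperGradient (fun x => ((⨆ n, v n x : ℝ) : EReal)) (fun x => ⨆ n, g n x) ∧
    ∫⁻ x, ‖⨆ n, v n x‖ₑ ^ p ∂μ + ∫⁻ x, (⨆ n, g n x) ^ p ∂μ ≤
      ∑' n, (∫⁻ x, ‖v n x‖ₑ ^ p ∂μ + ∫⁻ x, g n x ^ p ∂μ) := by
  have hb : ∀ x, BddAbove (range fun n => v n x) := fun x =>
    ⟨1, by rintro _ ⟨n, rfl⟩; exact (hv1 n x).2⟩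
  refine ⟨AEMeasurable.iSup hv, isUpperGradient_iSup hg hb, ?_⟩
  rw [ENNReal.tsum_add, ← lintegral_tsum (fun n => (hv n).enorm.pow_const p),
    ← lintegral_tsum (fun n => ((hg n).1.pow_const p).aemeasurable)]
  refine add_le_add (lintegral_mono fun x => ?_)
    (lintegral_mono fun x => iSup_rpow_le_tsum hp _)
  refine le_trans ?_ (iSup_rpow_le_tsum hp _)
  gcongr
  rw [Real.enorm_of_nonneg (Real.iSup_nonneg fun n => (hv1 n x).1)]
  refine ENNReal.ofReal_le_of_le_toReal (ciSup_le fun n => ?_)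
  rw [← ENNReal.ofReal_le_iff_le_toReal]
  · rw [← Real.enorm_of_nonneg (hv1 n x).1]
    exact le_iSup (fun n => ‖v n x‖ₑ) n
  · refine ((iSup_le fun n => ?_ : (⨆ n, ‖v n x‖ₑ) ≤ 1).trans_lt (by simp)).ne
    rw [Real.enorm_of_nonneg (hv1 n x).1]
    simpa using (hv1 n x).2

lemma sobolevCapacity_iUnion_le {ι : Type*} [Countable ι] [Nonempty ι] (hp : 0 < p)
    (E : ι → Set X) :
    sobolevCapacity p μ (⋃ n, E n) ≤ ∑' n, sobolevCapacity p μ (E n) := by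
  rcases eq_or_ne (∑' n, sobolevCapacity p μ (E n)) ⊤ with htop | htop
  · rw [htop]; exact le_top
  refine ENNReal.le_of_forall_pos_le_add fun ε hε _ => ?_
  obtain ⟨δ, hδ, hsum⟩ := ENNReal.exists_pos_sum_of_countable' (ENNReal.coe_ne_zero.2 hε.ne') ι
  have hlt : ∀ n, sobolevCapacity p μ (E n) < sobolevCapacity p μ (E n) + δ n := fun n =>
    ENNReal.lt_add_right (ENNReal.ne_top_of_tsum_ne_top htop n) (hδ n).ne'
  choose v g hv hv1 hE hg hb using fun n => exists_of_sobolevCapacity_lt hp (hlt n)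
  obtain ⟨h1, h2, h3⟩ := exists_iSup_bound hp hv hv1 hg
  refine (sobolevCapacity_le hp h1 h2 ?_).trans (h3.trans ?_)
  · intro x hx
    obtain ⟨n, hn⟩ := mem_iUnion.1 hx
    rw [← hE n x hn]
    exact le_ciSup (f := fun n => v n x) ⟨1, by rintro _ ⟨n, rfl⟩; exact (hv1 n x).2⟩ n
  · calc _ ≤ ∑' n, (sobolevCapacity p μ (E n) + δ n) := ENNReal.tsum_le_tsum fun n => (hb n).le
      _ = _ := ENNReal.tsum_add
      _ ≤ _ := by gcongr

lemma sobolevCapacity_union_le (hp : 0 < p) (E F : Set X) :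
    sobolevCapacity p μ (E ∪ F) ≤ sobolevCapacity p μ E + sobolevCapacity p μ F := by
  rw [union_eq_iUnion, add_comm]
  refine (sobolevCapacity_iUnion_le hp _).trans_eq ?_
  rw [tsum_bool, cond_false, cond_true]

end Capacity

/-! ### Doubling and completeness give properness. -/

section Doubling

variable {X : Type*} [MetricSpace X] [MeasurableSpace X] {μ : Measure X}

lemma IsDoubling.exists_iterate (h : IsDoubling μ) : ∃ C : ℝ≥0, 1 ≤ C ∧ ∀ (k : ℕ) (x : X) (r : ℝ),
    0 < r → μ (Metric.ball x (2 ^ k * r)) ≤ C ^ k * μ (Metric.ball x r) := by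
  obtain ⟨C, hC⟩ := h.2
  have hC' : ∀ (x : X) (r : ℝ), 0 < r →
      μ (Metric.ball x (2 * r)) ≤ (max 1 C : ℝ≥0) * μ (Metric.ball x r) := fun x r hr =>
    (hC x r hr).trans (by gcongr; exact le_max_right _ _)
  refine ⟨max 1 C, le_max_left _ _, fun k x r hr => ?_⟩
  induction k with
  | zero => simp
  | succ k ih =>
    calc μ (Metric.ball x (2 ^ (k + 1) * r)) = μ (Metric.ball x (2 * (2 ^ k * r))) := by ring_nf
      _ ≤ (max 1 C : ℝ≥0) * μ (Metric.ball x (2 ^ k * r)) := hC' _ _ (by positivity)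
      _ ≤ (max 1 C : ℝ≥0) * ((max 1 C : ℝ≥0) ^ k * μ (Metric.ball x r)) := by gcongr
      _ = _ := by rw [pow_succ]; ring

/-- Disjoint balls of radius `ε / 8` centred in a fixed ball have measure bounded below by doubling,
so there are finitely many; their fivefold enlargements, of radius less than `ε`, cover. -/
lemma IsDoubling.properSpace [CompleteSpace X] [BorelSpace X] (h : IsDoubling μ) :
    ProperSpace X := by
  obtain ⟨C, -, hC⟩ := h.exists_iterate
  refine ⟨fun x R => ?_⟩
  refine TotallyBounded.isCompact_of_isClosed ?_ Metric.isClosed_closedBall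
  refine (?_ : TotallyBounded (Metric.ball x (|R| + 1))).subset
    (Metric.closedBall_subset_ball (by linarith [le_abs_self R]))
  generalize hR' : |R| + 1 = R'
  have hR0 : 0 < R' := by rw [← hR']; positivity
  refine Metric.totallyBounded_iff.2 fun ε hε => ?_
  obtain ⟨u, hu, hdisj, hcov⟩ := Vitali.exists_disjoint_subfamily_covering_enlargement_closedBall
    (Metric.ball x R') id (fun _ => ε / 8) (ε / 8) (fun _ _ => le_rfl) 5 (by norm_num)
  refine ⟨u, ?_, fun a ha => ?_⟩
  · obtain ⟨k, hk⟩ := pow_unbounded_of_one_lt (2 * R' / (ε / 8)) (one_lt_two (α := ℝ))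
    have hk' : 2 * R' ≤ 2 ^ k * (ε / 8) := ((div_lt_iff₀ (by positivity)).1 hk).le
    set c : ℝ≥0∞ := μ (Metric.ball x R') / C ^ k with hc
    have hlow : ∀ b ∈ u, c ≤ μ (Metric.closedBall b (ε / 8)) := by
      intro b hb
      refine ENNReal.div_le_of_le_mul' ?_
      calc μ (Metric.ball x R') ≤ μ (Metric.ball b (2 ^ k * (ε / 8))) := by
            refine measure_mono (Metric.ball_subset_ball' ?_)
            have := hu hb
            rw [Metric.mem_ball, dist_comm] at this
            linarith
        _ ≤ C ^ k * μ (Metric.ball b (ε / 8)) := hC k b _ (by positivity)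
        _ ≤ _ := by gcongr; exact Metric.ball_subset_closedBall
    have hfin := Measure.finite_const_le_meas_of_disjoint_iUnion (ι := u) μ (ε := c)
      (As := fun b => Metric.closedBall (b : X) (ε / 8))
      (ENNReal.div_pos (h.1 x R' hR0).1.ne' (by simp))
      (fun _ => Metric.isClosed_closedBall.measurableSet)
      (fun a b hab => hdisj a.2 b.2 (fun hne => hab (Subtype.ext hne)))
      (((measure_mono (iUnion_subset fun b => Metric.closedBall_subset_ball'
        (ε₂ := R' + ε) ?_)).trans_lt (h.1 x _ (by positivity)).2).ne)
    · have : {i : u | c ≤ μ (Metric.closedBall (i : X) (ε / 8))} = univ :=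
        eq_univ_of_forall fun b => hlow b b.2
      rw [this] at hfin
      exact Set.finite_coe_iff.1 (Set.finite_univ_iff.1 hfin)
    · have := hu b.2
      rw [Metric.mem_ball] at this
      linarith
  · obtain ⟨b, hb, hab⟩ := hcov a ha
    refine mem_iUnion₂.2 ⟨b, hb, ?_⟩
    have : a ∈ Metric.closedBall b (5 * (ε / 8)) := hab (Metric.mem_closedBall_self (by positivity))
    rw [Metric.mem_closedBall] at this
    rw [Metric.mem_ball]
    linarith

lemma IsDoubling.isLocallyFiniteMeasure (h : IsDoubling μ) : IsLocallyFiniteMeasure μ :=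
  ⟨fun x => ⟨Metric.ball x 1, Metric.ball_mem_nhds x one_pos, (h.1 x 1 one_pos).2⟩⟩

end Doubling

/-! ### From Lipschitz curves to arc length parametrizations. -/

section Reparametrization

/-- A `1`-Lipschitz map does not increase one-dimensional Hausdorff measure, so Lebesgue measure on
`[0, l]` is dominated by the pushforward of Lebesgue measure on `[0, τ]`. -/
lemma lintegral_Icc_le_comp_of_lipschitz {s : ℝ → ℝ} (hs : LipschitzWith 1 s) {h : ℝ → ℝ≥0∞}
    (hh : Measurable h) {l τ : ℝ} (hsub : Icc 0 l ⊆ s '' Icc 0 τ) :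
    ∫⁻ x in Icc 0 l, h x ≤ ∫⁻ t in Icc 0 τ, h (s t) := by
  rw [← lintegral_map hh hs.continuous.measurable]
  refine lintegral_mono' (Measure.le_iff.2 fun B hB => ?_) le_rfl
  rw [Measure.restrict_apply hB, Measure.map_apply hs.continuous.measurable hB,
    Measure.restrict_apply (hs.continuous.measurable hB)]
  calc volume (B ∩ Icc 0 l) ≤ volume (s '' (s ⁻¹' B ∩ Icc 0 τ)) := by
        refine measure_mono ?_
        rintro x ⟨hxB, hx⟩
        obtain ⟨t, ht, rfl⟩ := hsub hx
        exact ⟨t, ⟨hxB, ht⟩, rfl⟩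
    _ ≤ _ := by
        have := (hs.lipschitzOnWith (s := s ⁻¹' B ∩ Icc 0 τ)).hausdorffMeasure_image_le
          (d := 1) zero_le_one
        simpa [hausdorffMeasure_real] using this

variable {X : Type*} [MetricSpace X]

lemma eVariationOn_Icc_le_of_lipschitz {γ : ℝ → X} (hγ : LipschitzWith 1 γ) (s : Set ℝ) {a b : ℝ}
    (hab : a ≤ b) : eVariationOn γ (s ∩ Icc a b) ≤ ENNReal.ofReal (b - a) := by
  have h1 : eVariationOn γ (Icc a b) ≤ (1 : ℝ≥0) * eVariationOn (fun t : ℝ => t) (Icc a b) :=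
    (hγ.lipschitzOnWith (s := univ)).comp_eVariationOn_le (g := fun t : ℝ => t)
      (mapsTo_univ _ _)
  have h2 : eVariationOn (fun t : ℝ => t) (Icc a b) ≤ ENNReal.ofReal (b - a) := by
    have := (((monotone_id (α := ℝ)).monotoneOn (Icc a b)).eVariationOn_eq
      (left_mem_Icc.2 hab) (right_mem_Icc.2 hab)).le
    rwa [inter_self] at this
  calc eVariationOn γ (s ∩ Icc a b) ≤ eVariationOn γ (Icc a b) :=
        eVariationOn.mono _ inter_subset_right
    _ ≤ _ := by simpa using h1.trans (mul_le_mul_right h2 _)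

/-- A nonclosed `1`-Lipschitz curve has an arc length parametrization along which integrals do not
increase. -/
lemma exists_unitSpeed_reparametrization [MeasurableSpace X] [BorelSpace X] {γ : ℝ → X}
    (hγ : LipschitzWith 1 γ) {τ : ℝ} (hτ : 0 ≤ τ) (hne : γ 0 ≠ γ τ) :
    ∃ (l : ℝ) (σ : ℝ → X), 0 < l ∧ HasUnitSpeedOn σ (Icc 0 l) ∧ σ 0 = γ 0 ∧
      ∀ F : X → ℝ≥0∞, Measurable F → lineIntegral F σ l ≤ ∫⁻ t in Icc 0 τ, F (γ t) := by
  set S : Set ℝ := Icc 0 τ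
  have h0 : (0 : ℝ) ∈ S := left_mem_Icc.2 hτ
  have hτS : τ ∈ S := right_mem_Icc.2 hτ
  have hbv : LocallyBoundedVariationOn γ S := hγ.locallyBoundedVariationOn S
  set s : ℝ → ℝ := variationOnFromTo γ S 0 with hs
  have hmono : MonotoneOn s S := variationOnFromTo.monotoneOn hbv h0
  have hs0 : s 0 = 0 := variationOnFromTo.self _ _ _
  have hlip : LipschitzOnWith 1 s S := by
    refine LipschitzOnWith.of_le_add_mul 1 fun x hx y hy => ?_
    rcases le_total x y with hxy | hxy
    · have := hmono hx hy hxy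
      have := dist_nonneg (x := x) (y := y)
      simp only [NNReal.coe_one, one_mul]; linarith
    · have h1 : s y + variationOnFromTo γ S y x = s x := variationOnFromTo.add hbv h0 hy hx
      have h2 : variationOnFromTo γ S y x ≤ x - y := by
        rw [variationOnFromTo.eq_of_le _ _ hxy]
        exact ENNReal.toReal_le_of_le_ofReal (by linarith)
          (eVariationOn_Icc_le_of_lipschitz hγ S hxy)
      rw [NNReal.coe_one, one_mul, Real.dist_eq, abs_of_nonneg (by linarith)]
      linarith
  have himg : s '' S = Icc 0 (s τ) := by
    refine Subset.antisymm ?_ ?_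
    · rintro _ ⟨t, ht, rfl⟩
      exact ⟨hs0 ▸ hmono h0 ht ht.1, hmono ht hτS ht.2⟩
    · have := intermediate_value_Icc hτ hlip.continuousOn
      rwa [hs0] at this
  set σ : ℝ → X := naturalParameterization γ S 0 with hσ
  have hσs : ∀ t ∈ S, σ (s t) = γ t := fun t ht =>
    edist_eq_zero.1 (edist_naturalParameterization_eq_zero hbv h0 ht)
  have hunit : HasUnitSpeedOn σ (Icc 0 (s τ)) := by
    rw [← himg]
    exact has_unit_speed_naturalParameterization γ hbv h0
  have hl0 : 0 ≤ s τ := hs0 ▸ hmono h0 hτS hτ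
  have hl : 0 < s τ := by
    refine lt_of_le_of_ne hl0 fun h => hne ?_
    rw [← hσs 0 h0, ← hσs τ hτS, hs0, ← h]
  refine ⟨s τ, σ, hl, hunit, by rw [← hσs 0 h0, hs0], fun F hF => ?_⟩
  -- Freezing `σ` and `s` outside their intervals makes them globally continuous, hence measurable,
  -- without changing the integrals.
  let σ' : ℝ → X := fun x => σ (projIcc 0 (s τ) hl0 x)
  let s' : ℝ → ℝ := fun t => s (projIcc 0 τ hτ t)
  have hs' : LipschitzWith 1 s' := by
    have h1 : LipschitzWith 1 (fun t : S => s t) := hlip.to_restrict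
    have h2 := h1.comp (LipschitzWith.projIcc hτ)
    rwa [one_mul] at h2
  have hσ' : Continuous σ' := by
    have h1 : LipschitzWith 1 (fun t : Icc 0 (s τ) => σ t) :=
      (lipschitzOnWith_of_hasUnitSpeedOn hunit).to_restrict
    exact h1.continuous.comp continuous_projIcc
  have h2 := lintegral_Icc_le_comp_of_lipschitz hs' (h := fun x => F (σ' x))
    (hF.comp hσ'.measurable) (l := s τ) (τ := τ) (by
      rw [← himg]
      rintro _ ⟨t, ht, rfl⟩
      exact ⟨t, ht, by simp only [s', projIcc_of_mem hτ ht]⟩)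
  refine (le_of_eq ?_).trans (h2.trans (le_of_eq ?_))
  · refine setLIntegral_congr_fun measurableSet_Icc fun x hx => ?_
    simp only [σ', projIcc_of_mem hl0 hx]
  · refine setLIntegral_congr_fun measurableSet_Icc fun t ht => ?_
    have h3 : s t ∈ Icc 0 (s τ) := himg ▸ mem_image_of_mem s ht
    simp only [σ', s', projIcc_of_mem hτ ht, projIcc_of_mem hl0 h3, hσs t ht]

end Reparametrization

/-! ### The cost function behind small open neighbourhoods. -/

section UnitTimeCost

variable {X : Type*} [MetricSpace X]

/-- The least integral of `ρ` over the time interval `[0, 1]` along `1`-Lipschitz curves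
that start at `x`. -/
noncomputable def unitTimeCost (ρ : X → ℝ≥0∞) (x : X) : ℝ≥0∞ :=
  ⨅ (γ : ℝ → X) (_ : LipschitzWith 1 γ ∧ γ 0 = x), ∫⁻ t in Icc (0 : ℝ) 1, ρ (γ t)

lemma unitTimeCost_le {ρ : X → ℝ≥0∞} {γ : ℝ → X} (hγ : LipschitzWith 1 γ) {x : X} (h0 : γ 0 = x) :
    unitTimeCost ρ x ≤ ∫⁻ t in Icc (0 : ℝ) 1, ρ (γ t) :=
  iInf₂_le γ ⟨hγ, h0⟩

/-- Standing still is allowed, so the cost vanishes wherever `ρ` does. -/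
lemma unitTimeCost_le_of_const {ρ : X → ℝ≥0∞} (x : X) : unitTimeCost ρ x ≤ ρ x := by
  refine (unitTimeCost_le ((LipschitzWith.const x).weaken zero_le_one) rfl).trans ?_
  simp

/-- Appending `γ` after following `σ` up to time `l` keeps the `1`-Lipschitz property. -/
lemma lipschitzWith_concat {σ γ : ℝ → X} (hσ : LipschitzWith 1 σ) (hγ : LipschitzWith 1 γ) {l : ℝ}
    (h : γ 0 = σ l) : LipschitzWith 1 (fun t => if t ≤ l then σ t else γ (t - l)) := by
  have hσ' := hσ.dist_le_mul
  have hγ' := hγ.dist_le_mul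
  simp only [NNReal.coe_one, one_mul] at hσ' hγ'
  have key : ∀ s t : ℝ, s ≤ l → l < t → dist (σ s) (γ (t - l)) ≤ dist s t := by
    intro s t hs ht
    calc dist (σ s) (γ (t - l)) ≤ dist (σ s) (σ l) + dist (γ 0) (γ (t - l)) := by
          rw [h]; exact dist_triangle _ _ _
      _ ≤ dist s l + dist 0 (t - l) := add_le_add (hσ' _ _) (hγ' _ _)
      _ = dist s t := by
          rw [Real.dist_eq, Real.dist_eq, Real.dist_eq, abs_of_nonpos (by linarith),
            abs_of_nonpos (by linarith), abs_of_nonpos (by linarith)]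
          ring
  refine LipschitzWith.of_dist_le_mul fun s t => ?_
  simp only [NNReal.coe_one, one_mul]
  split_ifs with hs ht ht
  · exact hσ' s t
  · exact key s t hs (not_le.1 ht)
  · rw [dist_comm, dist_comm s t]
    exact key t s ht (not_le.1 hs)
  · simpa using hγ' (s - l) (t - l)

lemma unitTimeCost_le_add {ρ : X → ℝ≥0∞} {σ : ℝ → X} (hσ : LipschitzWith 1 σ) {l : ℝ}
    (hl : 0 ≤ l) :
    unitTimeCost ρ (σ 0) ≤ (∫⁻ t in Icc 0 l, ρ (σ t)) + unitTimeCost ρ (σ l) := by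
  rw [unitTimeCost, unitTimeCost, ENNReal.add_iInf]
  refine le_iInf fun γ => ?_
  rcases em (LipschitzWith 1 γ ∧ γ 0 = σ l) with hγ | hγ
  swap
  · simp [hγ]
  simp only [hγ, true_and, iInf_pos]
  set β : ℝ → X := fun t => if t ≤ l then σ t else γ (t - l) with hβ
  refine (unitTimeCost_le (lipschitzWith_concat hσ hγ.1 hγ.2) (by simp [hl])).trans ?_
  -- The concatenation lasts `l + 1` units of time and the cost counts only the first unit, so the
  -- longer interval gives an upper bound.
  calc ∫⁻ t in Icc (0 : ℝ) 1, ρ (β t) ≤ ∫⁻ t in Icc 0 l ∪ Icc l (l + 1), ρ (β t) := by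
        refine lintegral_mono_set ?_
        rintro t ⟨h0, h1⟩
        rcases le_total t l with ht | ht
        · exact Or.inl ⟨h0, ht⟩
        · exact Or.inr ⟨ht, by linarith⟩
    _ ≤ (∫⁻ t in Icc 0 l, ρ (β t)) + ∫⁻ t in Icc l (l + 1), ρ (β t) := lintegral_union_le _ _ _
    _ = _ := by
        congr 1
        · refine setLIntegral_congr_fun measurableSet_Icc fun t ht => ?_
          simp only [hβ, if_pos ht.2]
        · rw [← lintegral_Icc_shift, add_sub_cancel_left]
          refine setLIntegral_congr_fun measurableSet_Icc fun t ht => ?_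
          rcases ht.1.eq_or_lt with rfl | ht'
          · simp [hβ, hγ.2]
          · simp [hβ, not_le.2 ht']

lemma unitTimeCost_le_add' {ρ : X → ℝ≥0∞} {σ : ℝ → X} (hσ : LipschitzWith 1 σ) {l : ℝ}
    (hl : 0 ≤ l) :
    unitTimeCost ρ (σ l) ≤ (∫⁻ t in Icc 0 l, ρ (σ t)) + unitTimeCost ρ (σ 0) := by
  have h1 : LipschitzWith 1 (fun t => σ (l - t)) := by
    refine LipschitzWith.of_dist_le_mul fun s t => ?_
    refine (hσ.dist_le_mul _ _).trans (le_of_eq ?_)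
    rw [dist_sub_left]
  have h2 := unitTimeCost_le_add (ρ := ρ) h1 hl
  simp only [sub_zero, sub_self] at h2
  refine h2.trans_eq ?_
  congr 1
  have h := (Measure.measurePreserving_sub_left (volume : Measure ℝ) l).setLIntegral_comp_preimage_emb
    (MeasurableEquiv.subLeft l).measurableEmbedding (fun t => ρ (σ t)) (Icc 0 l)
  rw [← h]
  congr 2
  simp

lemma edist_toReal_min_one_le {a b M : ℝ≥0∞} (h1 : a ≤ M + b) (h2 : b ≤ M + a) :
    edist (min 1 a).toReal (min 1 b).toReal ≤ M := by
  rcases eq_or_ne M ⊤ with rfl | hM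
  · exact le_top
  have key : ∀ a b : ℝ≥0∞, a ≤ M + b → min 1 a ≤ M + min 1 b := fun a b h => by
    rcases le_total 1 b with hb | hb
    · rw [min_eq_left hb]
      exact (min_le_left _ _).trans le_add_self
    · rw [min_eq_right hb]
      exact (min_le_right _ _).trans h
  have h1' := key a b h1
  have h2' := key b a h2
  have ha : min 1 a ≠ ⊤ := ((min_le_left _ _).trans_lt (by simp)).ne
  have hb : min 1 b ≠ ⊤ := ((min_le_left _ _).trans_lt (by simp)).ne
  generalize min 1 a = A at *
  generalize min 1 b = B at *
  lift A to ℝ≥0 using ha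
  lift B to ℝ≥0 using hb
  lift M to ℝ≥0 using hM
  norm_cast at h1' h2'
  rw [ENNReal.coe_toReal, ENNReal.coe_toReal, edist_nndist, ENNReal.coe_le_coe,
    ← NNReal.coe_le_coe, coe_nndist, Real.dist_eq, abs_le]
  have h3 : (A : ℝ) ≤ M + B := by exact_mod_cast h1'
  have h4 : (B : ℝ) ≤ M + A := by exact_mod_cast h2'
  constructor <;> linarith

/-- Running first along the curve, in either direction, and then along a near-optimal competitor
compares the costs at its two endpoints. Truncation at `1` keeps the comparison and removes infinite
values. -/
lemma isUpperGradient_unitTimeCost [MeasurableSpace X] {ρ : X → ℝ≥0∞} (hρ : Measurable ρ) :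
    IsUpperGradient (fun x => ((min 1 (unitTimeCost ρ x)).toReal : EReal)) ρ := by
  refine isUpperGradient_coe_iff.2 ⟨hρ, fun l γ hl hγ => ?_⟩
  let σ : ℝ → X := fun t => γ (projIcc 0 l hl.le t)
  have hσ : LipschitzWith 1 σ := by
    have h1 : LipschitzWith 1 (fun t : Icc 0 l => γ t) :=
      (lipschitzOnWith_of_hasUnitSpeedOn hγ).to_restrict
    have h2 := h1.comp (LipschitzWith.projIcc hl.le)
    rwa [one_mul] at h2
  have hσγ : ∀ t ∈ Icc 0 l, σ t = γ t := fun t ht => by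
    simp only [σ, projIcc_of_mem hl.le ht]
  have hint : ∫⁻ t in Icc 0 l, ρ (σ t) = lineIntegral ρ γ l :=
    setLIntegral_congr_fun measurableSet_Icc fun t ht => by simp only [hσγ t ht]
  rw [← hint, ← hσγ 0 (left_mem_Icc.2 hl.le), ← hσγ l (right_mem_Icc.2 hl.le)]
  exact edist_toReal_min_one_le (unitTimeCost_le_add hσ hl.le) (unitTimeCost_le_add' hσ hl.le)

/-- `1`-Lipschitz curves with convergent starting points subconverge pointwise on `[0, 1]`. -/
lemma exists_subseq_tendsto_lipschitz [ProperSpace X] {γ : ℕ → ℝ → X}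
    (hγ : ∀ n, LipschitzWith 1 (γ n)) {x : X} (hx : Tendsto (fun n => γ n 0) atTop (𝓝 x)) :
    ∃ (β : ℝ → X) (φ : ℕ → ℕ), StrictMono φ ∧ LipschitzWith 1 β ∧ β 0 = x ∧
      ∀ t ∈ Icc (0 : ℝ) 1, Tendsto (fun n => γ (φ n) t) atTop (𝓝 (β t)) := by
  obtain ⟨R, hR⟩ := (Metric.isBounded_range_of_tendsto _ hx).subset_closedBall x
  let F : ℕ → BoundedContinuousFunction unitInterval X := fun n =>
    BoundedContinuousFunction.mkOfCompact
      ⟨fun t => γ n t, (hγ n).continuous.comp continuous_subtype_val⟩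
  have hF : ∀ n (t : unitInterval), F n t = γ n t := fun _ _ => rfl
  have hcomp := BoundedContinuousFunction.arzela_ascoli (Metric.closedBall x (R + 1))
    (isCompact_closedBall _ _) (range F) (by
      rintro _ t ⟨n, rfl⟩
      rw [hF, Metric.mem_closedBall]
      have h1 : dist (γ n t) (γ n 0) ≤ 1 := by
        refine ((hγ n).dist_le_mul _ _).trans ?_
        simpa [abs_of_nonneg t.2.1] using t.2.2
      have h2 : dist (γ n 0) x ≤ R := hR ⟨n, rfl⟩
      linarith [dist_triangle (γ n t) (γ n 0) x]) (by
      refine (LipschitzWith.uniformEquicontinuous _ 1 ?_).equicontinuous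
      rintro ⟨_, n, rfl⟩
      exact fun s t => hγ n s t)
  obtain ⟨G, -, φ, hφ, hG⟩ := hcomp.isSeqCompact (fun n => subset_closure (mem_range_self (f := F) n))
  have hpt : ∀ t : unitInterval, Tendsto (fun n => γ (φ n) t) atTop (𝓝 (G t)) := fun t =>
    ((BoundedContinuousFunction.lipschitz_eval_const t).continuous.tendsto G).comp hG
  have hGl : LipschitzWith 1 (G : unitInterval → X) := by
    refine LipschitzWith.of_dist_le_mul fun s t => ?_
    exact le_of_tendsto ((hpt s).dist (hpt t))
      (Eventually.of_forall fun n => (hγ (φ n)).dist_le_mul s t)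
  refine ⟨fun t => G (projIcc 0 1 zero_le_one t), φ, hφ, ?_, ?_, fun t ht => ?_⟩
  · have h2 := hGl.comp (LipschitzWith.projIcc (zero_le_one (α := ℝ)))
    rwa [one_mul] at h2
  · refine tendsto_nhds_unique (hpt _) ?_
    have h2 := hx.comp hφ.tendsto_atTop
    simpa [Function.comp_def] using h2
  · simpa [projIcc_of_mem zero_le_one ht] using hpt ⟨t, ht⟩

/-- Near-optimal curves from convergent starting points subconverge by Arzelà–Ascoli; semicontinuity
of `ρ` and Fatou bound the cost of the limit curve. The fixed time interval is what makes this
compactness available. -/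
lemma lowerSemicontinuous_unitTimeCost [ProperSpace X] [MeasurableSpace X] [BorelSpace X]
    {ρ : X → ℝ≥0∞} (hρ : LowerSemicontinuous ρ) : LowerSemicontinuous (unitTimeCost ρ) := by
  refine lowerSemicontinuous_iff_isClosed_preimage.2 fun α => ?_
  rcases eq_or_ne α ⊤ with rfl | hα
  · simp
  refine IsSeqClosed.isClosed fun x y hx hxy => ?_
  have h1 : ∀ n : ℕ, ∃ γ : ℝ → X, (LipschitzWith 1 γ ∧ γ 0 = x n) ∧
      ∫⁻ t in Icc (0 : ℝ) 1, ρ (γ t) < α + ((n : ℝ≥0∞) + 1)⁻¹ := fun n => by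
    have h2 : unitTimeCost ρ (x n) < α + ((n : ℝ≥0∞) + 1)⁻¹ :=
      (show unitTimeCost ρ (x n) ≤ α from hx n).trans_lt (ENNReal.lt_add_right hα (by simp))
    simpa only [unitTimeCost, iInf_lt_iff, exists_prop] using h2
  choose γ hγ hlt using h1
  obtain ⟨β, φ, hφ, hβ, hβ0, hlim⟩ := exists_subseq_tendsto_lipschitz (fun n => (hγ n).1)
    (x := y) (by simpa only [(hγ _).2] using hxy)
  refine mem_Iic.2 ((unitTimeCost_le hβ hβ0).trans ?_)
  have hmeas : ∀ n, Measurable fun t => ρ (γ (φ n) t) := fun n =>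
    hρ.measurable.comp (hγ (φ n)).1.continuous.measurable
  calc ∫⁻ t in Icc (0 : ℝ) 1, ρ (β t)
      ≤ ∫⁻ t in Icc (0 : ℝ) 1, liminf (fun n => ρ (γ (φ n) t)) atTop := by
        refine setLIntegral_mono' measurableSet_Icc fun t ht => ?_
        exact (hρ.le_liminf (β t)).trans (liminf_le_liminf_of_le (hlim t ht))
    _ ≤ liminf (fun n => ∫⁻ t in Icc (0 : ℝ) 1, ρ (γ (φ n) t)) atTop :=
        lintegral_liminf_le hmeas
    _ ≤ liminf (fun n => α + ((φ n : ℝ≥0∞) + 1)⁻¹) atTop :=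
        liminf_le_liminf (Eventually.of_forall fun n => (hlt (φ n)).le)
    _ = α := by
        refine Tendsto.liminf_eq ?_
        have h3 : Tendsto (fun n : ℕ => ((n : ℝ≥0∞) + 1)⁻¹) atTop (𝓝 0) := by
          have := (tendsto_add_atTop_iff_nat 1).2 ENNReal.tendsto_inv_nat_nhds_zero
          simpa using this
        simpa using (tendsto_const_nhds (x := α)).add (h3.comp hφ.tendsto_atTop)

/-- If all nonconstant curves starting at `z` have infinite `g`-length, then leaving an open set
`V ∋ z` is expensive. -/
lemma one_le_unitTimeCost [MeasurableSpace X] [BorelSpace X] {g : X → ℝ≥0∞} (hg : Measurable g)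
    {V : Set X} (hV : IsOpen V) {z : X} (hz : z ∈ V)
    (hex : ∀ (l : ℝ) (γ : ℝ → X), 0 < l → HasUnitSpeedOn γ (Icc 0 l) → γ 0 = z →
      lineIntegral g γ l = ⊤) : 1 ≤ unitTimeCost (V.indicator fun x => g x + 1) z := by
  refine le_iInf₂ fun γ hγ => ?_
  -- A curve that stays in `V` for the whole unit of time pays at least `1` through the summand `+
  -- 1`.
  by_cases hall : ∀ t ∈ Icc (0 : ℝ) 1, γ t ∈ V
  · calc (1 : ℝ≥0∞) = ∫⁻ t in Icc (0 : ℝ) 1, 1 := by simp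
      _ ≤ _ := by
        refine setLIntegral_mono' measurableSet_Icc fun t ht => ?_
        rw [indicator_of_mem (hall t ht)]
        exact le_add_self
  push Not at hall
  have hcpt : IsCompact (Icc (0 : ℝ) 1 ∩ γ ⁻¹' Vᶜ) :=
    isCompact_Icc.inter_right (hV.isClosed_compl.preimage hγ.1.continuous)
  obtain ⟨t0, ht0, ht0V⟩ := hall
  -- `τ` is the first exit time from `V`. The piece up to `τ` joins different points, so it has
  -- infinite `g`-cost, all of it incurred inside `V`.
  obtain ⟨τ, ⟨hτ, hτV⟩, hmin⟩ := hcpt.exists_isLeast ⟨t0, ht0, ht0V⟩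
  have hin : ∀ t ∈ Ico 0 τ, γ t ∈ V := fun t ht => by
    by_contra hcon
    exact absurd (hmin ⟨⟨ht.1, ht.2.le.trans hτ.2⟩, hcon⟩) (not_le.2 ht.2)
  have hne : γ 0 ≠ γ τ := fun h => hτV (by rw [← h, hγ.2]; exact hz)
  obtain ⟨l, σ, hl, hσ, hσ0, hle⟩ := exists_unitSpeed_reparametrization hγ.1 hτ.1 hne
  have h1 := hle g hg
  rw [hex l σ hl hσ (hσ0.trans hγ.2), top_le_iff] at h1
  calc (1 : ℝ≥0∞) ≤ ∫⁻ t in Icc 0 τ, g (γ t) := by rw [h1]; exact le_top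
    _ = ∫⁻ t in Ico 0 τ, g (γ t) := setLIntegral_congr Ico_ae_eq_Icc.symm
    _ ≤ ∫⁻ t in Ico 0 τ, V.indicator (fun x => g x + 1) (γ t) := by
        refine setLIntegral_mono' measurableSet_Ico fun t ht => ?_
        rw [indicator_of_mem (hin t ht)]
        exact le_self_add
    _ ≤ _ := lintegral_mono_set (Ico_subset_Icc_self.trans (Icc_subset_Icc_right hτ.2))

end UnitTimeCost

/-- A null set whose points are not reached by curves of finite `g`-length, where `g ∈ L^p`, has
open neighbourhoods of arbitrarily small capacity. -/
lemma exists_isOpen_sobolevCapacity_le {X : Type*} [MetricSpace X] [ProperSpace X]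
    [MeasurableSpace X] [BorelSpace X] {μ : Measure X} [IsLocallyFiniteMeasure μ] {p : ℝ}
    (hp : 0 < p) {Z : Set X} (hZ : μ Z = 0) {g : X → ℝ≥0∞} (hg : Measurable g)
    (hgp : ∫⁻ x, g x ^ p ∂μ < ⊤)
    (hex : ∀ (l : ℝ) (γ : ℝ → X), 0 < l → HasUnitSpeedOn γ (Icc 0 l) → γ 0 ∈ Z →
      lineIntegral g γ l = ⊤) {ε : ℝ≥0∞} (hε : ε ≠ 0) :
    ∃ O, IsOpen O ∧ Z ⊆ O ∧ sobolevCapacity p μ O ≤ ε := by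
  -- Vitali–Carathéodory: a lower semicontinuous majorant of `g^p` that is still integrable.
  obtain ⟨G, hgG, hGlsc, hGint⟩ := exists_le_lowerSemicontinuous_lintegral_ge μ
    (fun x => g x ^ p) (hg.pow_const p) one_ne_zero
  set h : X → ℝ≥0∞ := fun x => G x ^ p⁻¹ with hh
  have hhlsc : LowerSemicontinuous h :=
    ENNReal.continuous_rpow_const.comp_lowerSemicontinuous hGlsc
      (ENNReal.monotone_rpow_of_nonneg (inv_nonneg.2 hp.le))
  have hgh : ∀ x, g x ≤ h x := fun x => by
    rw [hh, ENNReal.le_rpow_inv_iff hp]; exact hgG x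
  have hhp : ∀ x, h x ^ p = G x := fun x => ENNReal.rpow_inv_rpow hp.ne' _
  set D : X → ℝ≥0∞ := fun x => (h x + 1) ^ p with hD
  have hDle : ∀ x, D x ≤ 2 ^ p * (G x + 1) := fun x => by
    have h1 : h x + 1 ≤ 2 * max (h x) 1 := by
      rw [two_mul]; exact add_le_add (le_max_left _ _) (le_max_right _ _)
    calc D x ≤ (2 * max (h x) 1) ^ p := by simp only [hD]; gcongr
      _ = 2 ^ p * (max (h x) 1) ^ p := ENNReal.mul_rpow_of_nonneg _ _ hp.le
      _ ≤ 2 ^ p * (G x + 1) := by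
          gcongr
          rw [(ENNReal.monotone_rpow_of_nonneg hp.le).map_max, hhp, ENNReal.one_rpow]
          exact max_le le_self_add le_add_self
  have hGfin : ∫⁻ x, G x ∂μ < ⊤ := hGint.trans_lt (by simpa using hgp)
  -- Outer regularity of this weighted measure yields an open `V ⊇ Z` over which the integral of `(h
  -- + 1)^p` is small.
  set ν := μ.withDensity D with hν
  have : IsLocallyFiniteMeasure ν := by
    refine ⟨fun x => ?_⟩
    obtain ⟨U, hU, hUfin⟩ := μ.finiteAt_nhds x
    obtain ⟨W, hWU, hWo, hxW⟩ := mem_nhds_iff.1 hU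
    refine ⟨W, hWo.mem_nhds hxW, ?_⟩
    rw [hν, withDensity_apply _ hWo.measurableSet]
    calc ∫⁻ x in W, D x ∂μ ≤ ∫⁻ x in W, 2 ^ p * (G x + 1) ∂μ := lintegral_mono hDle
      _ = 2 ^ p * (∫⁻ x in W, G x ∂μ + μ W) := by
          rw [lintegral_const_mul' _ _ (by finiteness), lintegral_add_right _ measurable_const]
          simp
      _ < ⊤ := by
          refine ENNReal.mul_lt_top (by finiteness) (ENNReal.add_lt_top.2 ⟨?_, ?_⟩)
          · exact (setLIntegral_le_lintegral _ _).trans_lt hGfin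
          · exact (measure_mono hWU).trans_lt hUfin
  have hνZ : ν Z = 0 := withDensity_absolutelyContinuous _ _ hZ
  -- The `1` pays for the function and `2 ^ p` for the gradient, doubled along with the function in
  -- passing from level `1/2` to level `1`.
  set c : ℝ≥0∞ := 1 + 2 ^ p with hc
  have hct : c ≠ ⊤ := by finiteness
  obtain ⟨V, hZV, hV, hνV⟩ := Z.exists_isOpen_lt_of_lt (ε / c) (by
    rw [hνZ]; exact ENNReal.div_pos hε hct) (μ := ν)
  have hνV' : ν V = ∫⁻ x in V, D x ∂μ := withDensity_apply _ hV.measurableSet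
  set ρ : X → ℝ≥0∞ := V.indicator fun x => h x + 1 with hρ
  have hρlsc : LowerSemicontinuous ρ := by
    rw [lowerSemicontinuous_iff_isOpen_preimage]
    intro a
    have h1 : ρ ⁻¹' Ioi a = V ∩ (fun x => h x + 1) ⁻¹' Ioi a := by
      ext x
      by_cases hx : x ∈ V <;> simp [hρ, hx]
    rw [h1]
    exact hV.inter ((hhlsc.add lowerSemicontinuous_const).isOpen_preimage a)
  set C := unitTimeCost ρ with hC
  have hClsc : LowerSemicontinuous C := lowerSemicontinuous_unitTimeCost hρlsc
  have hC1 : ∀ z ∈ Z, 1 ≤ C z := fun z hz => one_le_unitTimeCost hhlsc.measurable hV (hZV hz)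
    fun l γ hl hγ h0 => top_le_iff.1 ((hex l γ hl hγ (h0 ▸ hz)).symm.le.trans
      (lintegral_mono fun t => hgh _))
  have hC0 : ∀ x ∉ V, C x = 0 := fun x hx => by
    simpa [hρ, hx] using unitTimeCost_le_of_const (ρ := ρ) x
  set v : X → ℝ := fun x => (min 1 (C x)).toReal with hv
  have hCm : Measurable C := hClsc.measurable
  have hug := (isUpperGradient_unitTimeCost hρlsc.measurable).comp
    (edist_truncAbs_le two_ne_zero)
  refine ⟨C ⁻¹' Ioi (1 / 2), hClsc.isOpen_preimage _, fun z hz => ?_, ?_⟩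
  · exact lt_of_lt_of_le (by simp) (hC1 z hz)
  refine (sobolevCapacity_le hp ((measurable_truncAbs 2).comp (measurable_coe_real_ereal.comp
    (measurable_const.min hCm).ennreal_toReal)).aemeasurable hug ?_).trans ?_
  · intro x hx
    refine (truncAbs_eq_one ?_).ge
    have h1 : (1 : ℝ≥0∞) / 2 ≤ min 1 (C x) := le_min (by simp) hx.le
    rw [Function.comp_apply, abs_coe_eq_enorm, Real.enorm_of_nonneg ENNReal.toReal_nonneg, ENNReal.ofReal_toReal
      ((min_le_left _ _).trans_lt (by simp)).ne]
    calc (1 : ℝ≥0∞) = 2 * (1 / 2) := by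
          rw [ENNReal.mul_div_cancel two_ne_zero ENNReal.ofNat_ne_top]
      _ ≤ _ := by push_cast; gcongr
  · have hDone : ∀ x, 1 ≤ D x := fun x => ENNReal.one_le_rpow le_add_self hp
    have e1 : ∫⁻ x, ‖truncAbs 2 (v x)‖ₑ ^ p ∂μ ≤ ν V := by
      rw [hνV', ← lintegral_indicator hV.measurableSet]
      refine lintegral_mono fun x => ?_
      by_cases hx : x ∈ V
      · rw [indicator_of_mem hx, ofReal_truncAbs]
        exact (ENNReal.rpow_le_one (min_le_left _ _) hp.le).trans (hDone x)
      · simp [hv, hC0 x hx, ofReal_truncAbs, hp]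
    have e2 : ∫⁻ x, ((2 : ℝ≥0) * ρ x) ^ p ∂μ ≤ 2 ^ p * ν V := by
      rw [hνV', ← lintegral_indicator hV.measurableSet, ← lintegral_const_mul' _ _ (by finiteness)]
      refine lintegral_mono fun x => ?_
      rw [ENNReal.mul_rpow_of_nonneg _ _ hp.le]
      by_cases hx : x ∈ V
      · simp [hρ, hx, hD]
      · simp [hρ, hx, hp]
    calc _ ≤ ν V + 2 ^ p * ν V := add_le_add e1 e2
      _ = c * ν V := by rw [hc, add_mul, one_mul]
      _ ≤ c * (ε / c) := by gcongr
      _ ≤ ε := ENNReal.mul_div_le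

/-! ### Localizing upper gradients to the set where a function is nonzero. -/

section Gluing

/-- If `k` vanishes on a closed set `S`, then its increment is controlled by the integral over the
complement of `S`. -/
lemma edist_le_lintegral_of_eq_zero_on {k : ℝ → ℝ} {G G' : ℝ → ℝ≥0∞} {l : ℝ} (hl : 0 ≤ l)
    {S : Set ℝ} (hS : IsCompact S) (hSl : S ⊆ Icc 0 l) (hk : ∀ t ∈ S, k t = 0)
    (hG : ∀ a b, 0 ≤ a → a ≤ b → b ≤ l → edist (k a) (k b) ≤ ∫⁻ t in Icc a b, G t)
    (hGG' : ∀ᵐ t ∂(volume.restrict (Icc 0 l)), t ∉ S → G t ≤ G' t) :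
    edist (k 0) (k l) ≤ ∫⁻ t in Icc 0 l, G' t := by
  rcases S.eq_empty_or_nonempty with rfl | hne
  · refine (hG 0 l le_rfl hl le_rfl).trans (lintegral_mono_ae ?_)
    filter_upwards [hGG'] with t ht using ht (by simp)
  obtain ⟨a, haS, ha⟩ := hS.exists_isLeast hne
  obtain ⟨b, hbS, hb⟩ := hS.exists_isGreatest hne
  have hal := hSl haS
  have hbl := hSl hbS
  have hae : ∀ J : Set ℝ, J ⊆ Icc 0 l → MeasurableSet J → Disjoint J S →
      ∫⁻ t in J, G t ≤ ∫⁻ t in J, G' t := fun J hJ hJm hdisj => by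
    refine lintegral_mono_ae ?_
    filter_upwards [ae_restrict_of_ae_restrict_of_subset hJ hGG', ae_restrict_mem hJm] with t ht htJ
    exact ht (disjoint_left.1 hdisj htJ)
  -- With `a` and `b` the first and last zeros of `k` in `S`, only the pieces before `a` and after
  -- `b` contribute, and both avoid `S`.
  calc edist (k 0) (k l) ≤ edist (k 0) (k a) + edist (k b) (k l) := by
        rw [hk a haS, hk b hbS]; exact edist_triangle _ _ _
    _ ≤ (∫⁻ t in Icc 0 a, G t) + ∫⁻ t in Icc b l, G t :=
        add_le_add (hG 0 a le_rfl hal.1 hal.2) (hG b l hbl.1 hbl.2 le_rfl)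
    _ = (∫⁻ t in Ico 0 a, G t) + ∫⁻ t in Ioc b l, G t := by
        rw [setLIntegral_congr Ico_ae_eq_Icc.symm, setLIntegral_congr Ioc_ae_eq_Icc.symm]
    _ ≤ (∫⁻ t in Ico 0 a, G' t) + ∫⁻ t in Ioc b l, G' t := by
        refine add_le_add (hae _ ?_ measurableSet_Ico ?_) (hae _ ?_ measurableSet_Ioc ?_)
        · exact fun t ht => ⟨ht.1, ht.2.le.trans hal.2⟩
        · exact disjoint_left.2 fun t ht htS => absurd (ha htS) (not_le.2 ht.2)
        · exact fun t ht => ⟨hbl.1.trans ht.1.le, ht.2⟩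
        · exact disjoint_left.2 fun t ht htS => absurd (hb htS) (not_le.2 ht.1)
    _ = ∫⁻ t in Ico 0 a ∪ Ioc b l, G' t := by
        rw [lintegral_union measurableSet_Ioc]
        exact disjoint_left.2 fun t ht ht' => absurd ht.2 (not_lt.2 ((ha hbS).trans ht'.1.le))
    _ ≤ _ := lintegral_mono_set (union_subset
        (Ico_subset_Icc_self.trans (Icc_subset_Icc_right hal.2))
        (Ioc_subset_Icc_self.trans (Icc_subset_Icc_left hbl.1)))

variable {X : Type*} [MetricSpace X] [MeasurableSpace X]

lemma isUpperGradient_indicator_of_eq_zero [BorelSpace X] {v : X → ℝ} {g : X → ℝ≥0∞}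
    (h : IsUpperGradient (fun x => (v x : EReal)) g) {U : Set X} (hU : IsOpen U)
    (hv : ∀ x ∉ U, v x = 0) : IsUpperGradient (fun x => (v x : EReal)) (U.indicator g) := by
  refine isUpperGradient_coe_iff.2 ⟨h.1.indicator hU.measurableSet, fun l γ hl hγ => ?_⟩
  refine edist_le_lintegral_of_eq_zero_on (k := fun t => v (γ t)) (G := fun t => g (γ t)) hl.le
    (S := Icc 0 l ∩ γ ⁻¹' Uᶜ) ?_ inter_subset_left (fun t ht => hv _ ht.2)
    (fun a b ha hab hb => h.edist_le hγ ha hab hb) ?_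
  · exact isCompact_Icc.of_isClosed_subset
      ((lipschitzOnWith_of_hasUnitSpeedOn hγ).continuousOn.preimage_isClosed_of_isClosed isClosed_Icc
        hU.isClosed_compl) inter_subset_left
  · filter_upwards [ae_restrict_mem measurableSet_Icc] with t ht htS
    have : γ t ∈ U := by
      by_contra hcon
      exact htS ⟨ht, hcon⟩
    rw [indicator_of_mem this]

lemma edist_sub_sub_le (a b c d : ℝ) : edist (a - b) (c - d) ≤ edist a c + edist b d := by
  rw [edist_dist, edist_dist, edist_dist, ← ENNReal.ofReal_add dist_nonneg dist_nonneg]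
  exact ENNReal.ofReal_le_ofReal (dist_sub_sub_le _ _ _ _)

lemma isUpperGradient_sub [BorelSpace X] {u v : X → ℝ} {g h : X → ℝ≥0∞}
    (hu : IsUpperGradient (fun x => (u x : EReal)) g)
    (hv : IsUpperGradient (fun x => (v x : EReal)) h) :
    IsUpperGradient (fun x => ((u x - v x : ℝ) : EReal)) (fun x => g x + h x) := by
  refine isUpperGradient_coe_iff.2 ⟨hu.1.add hv.1, fun l γ hl hγ => ?_⟩
  rw [lineIntegral, lintegral_add_left' (f := fun t => g (γ t))
    (hu.1.comp_aemeasurable (aemeasurable_comp_curve hγ))]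
  exact (edist_sub_sub_le _ _ _ _).trans
    (add_le_add ((isUpperGradient_coe_iff.1 hu).2 l γ hl hγ)
      ((isUpperGradient_coe_iff.1 hv).2 l γ hl hγ))

lemma isUpperGradient_of_lipschitzWith {L : X → ℝ} {κ : ℝ≥0} (hL : LipschitzWith κ L) :
    IsUpperGradient (fun x => (L x : EReal)) (fun _ => κ) := by
  refine isUpperGradient_coe_iff.2 ⟨measurable_const, fun l γ hl hγ => ?_⟩
  refine (hL _ _).trans ?_
  have h1 := lipschitzOnWith_of_hasUnitSpeedOn hγ (left_mem_Icc.2 hl.le) (right_mem_Icc.2 hl.le)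
  simp only [lineIntegral, lintegral_const, Measure.restrict_apply, MeasurableSet.univ, univ_inter,
    Real.volume_Icc]
  gcongr
  refine h1.trans ?_
  rw [edist_comm, edist_dist, Real.dist_eq]
  simp [abs_of_pos hl]

/-- Absolute continuity of the integral of `g` along a curve of finite `g`-length. -/
lemma continuousOn_comp_curve {v : X → ℝ} {g : X → ℝ≥0∞}
    (h : IsUpperGradient (fun x => (v x : EReal)) g) {γ : ℝ → X} {l : ℝ}
    (hγ : HasUnitSpeedOn γ (Icc 0 l)) (hfin : lineIntegral g γ l ≠ ⊤) :
    ContinuousOn (fun t => v (γ t)) (Icc 0 l) := by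
  intro t ht
  rw [ContinuousWithinAt, tendsto_iff_edist_tendsto_0]
  have h1 : Tendsto (fun s => ∫⁻ r in uIcc s t, g (γ r) ∂(volume.restrict (Icc 0 l)))
      (𝓝[Icc 0 l] t) (𝓝 0) := by
    refine tendsto_setLIntegral_zero hfin ?_
    refine tendsto_of_tendsto_of_tendsto_of_le_of_le tendsto_const_nhds (h := fun s =>
      ENNReal.ofReal |t - s|) ?_ (fun _ => zero_le) fun s => ?_
    · have h2 : Tendsto (fun s => ENNReal.ofReal |t - s|) (𝓝 t) (𝓝 (ENNReal.ofReal |t - t|)) :=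
        (ENNReal.continuous_ofReal.comp (by fun_prop)).tendsto t
      simp only [sub_self, abs_zero, ENNReal.ofReal_zero] at h2
      exact h2.mono_left nhdsWithin_le_nhds
    · refine (Measure.restrict_apply_le _ _).trans ?_
      simp
  refine tendsto_of_tendsto_of_tendsto_of_le_of_le' tendsto_const_nhds h1
    (Eventually.of_forall fun _ => zero_le) ?_
  filter_upwards [self_mem_nhdsWithin] with s hs
  rw [Measure.restrict_restrict measurableSet_uIcc,
    inter_eq_self_of_subset_left (uIcc_subset_Icc hs ht)]
  rcases le_total s t with hst | hst
  · rw [uIcc_of_le hst]; exact h.edist_le hγ hs.1 hst ht.2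
  · rw [uIcc_of_ge hst, edist_comm]; exact h.edist_le hγ ht.1 hst hs.2

/-- The term `δ * g` is there so that a finite integral forces finite `g`-length; then `w - L` is
continuous along the curve and its zero set is closed. The term `⊤` on `N` lets the curve spend
almost no time in `N`. -/
lemma isUpperGradient_sub_of_eq_off [BorelSpace X] {w L : X → ℝ} {g : X → ℝ≥0∞} {κ : ℝ≥0}
    (hw : IsUpperGradient (fun x => (w x : EReal)) g) (hL : LipschitzWith κ L) {E N : Set X}
    (hE : MeasurableSet E) (hN : MeasurableSet N) (heq : ∀ x ∉ E ∪ N, w x = L x) {δ : ℝ≥0∞}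
    (hδ : δ ≠ 0) : IsUpperGradient (fun x => ((w x - L x : ℝ) : EReal))
      (fun x => E.indicator (fun x => g x + κ) x + N.indicator ⊤ x + δ * g x) := by
  have hug := isUpperGradient_sub hw (isUpperGradient_of_lipschitzWith hL)
  have hm : Measurable
      (fun x => E.indicator (fun x => g x + κ) x + N.indicator ⊤ x + δ * g x) :=
    (((hw.1.add_const _).indicator hE).add (Measurable.indicator measurable_const hN)).add
      (hw.1.const_mul δ)
  refine isUpperGradient_coe_iff.2 ⟨hm, fun l γ hl hγ => ?_⟩
  by_cases hfin : lineIntegral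
    (fun x => E.indicator (fun x => g x + κ) x + N.indicator ⊤ x + δ * g x) γ l = ⊤
  · rw [hfin]; exact le_top
  have hgfin : lineIntegral (fun x => g x + κ) γ l ≠ ⊤ := by
    have h1 : δ * lineIntegral g γ l ≠ ⊤ := by
      refine ne_top_of_le_ne_top hfin ((lintegral_const_mul_le _ _).trans ?_)
      exact lintegral_mono fun t => le_add_self
    have h2 : lineIntegral g γ l ≠ ⊤ := fun h => h1 (by rw [h, ENNReal.mul_top hδ])
    rw [lineIntegral, lintegral_add_right _ measurable_const]
    refine ENNReal.add_ne_top.2 ⟨h2, ?_⟩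
    simpa using ENNReal.mul_ne_top ENNReal.coe_ne_top ENNReal.ofReal_ne_top
  have hcont := continuousOn_comp_curve hug hγ hgfin
  refine edist_le_lintegral_of_eq_zero_on (k := fun t => w (γ t) - L (γ t))
    (G := fun t => g (γ t) + κ) hl.le (S := Icc 0 l ∩ (fun t => w (γ t) - L (γ t)) ⁻¹' {0}) ?_
    inter_subset_left (fun t ht => ht.2) (fun a b ha hab hb => hug.edist_le hγ ha hab hb) ?_
  · exact isCompact_Icc.of_isClosed_subset
      (hcont.preimage_isClosed_of_isClosed isClosed_Icc isClosed_singleton) inter_subset_left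
  · filter_upwards [ae_restrict_mem measurableSet_Icc,
      ae_notMem_of_lineIntegral_ne_top hγ (N := N) hm (fun x hx => by simp [hx]) hfin] with t ht htN htS
    have : γ t ∈ E := by
      by_contra hcon
      exact htS ⟨ht, by simp [heq (γ t) (fun h => h.elim hcon htN)]⟩
    rw [indicator_of_mem this, add_assoc]
    exact le_self_add

end Gluing

/-! ### Weak-type estimate for the restricted maximal function. -/

section WeakType

variable {X : Type*} [MetricSpace X] [MeasurableSpace X] [BorelSpace X] {μ : Measure X}

/-- The set where the maximal function of `G`, restricted to radii at most `R`, exceeds `τ`. -/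
def maximalSuperlevel (μ : Measure X) (G : X → ℝ≥0∞) (R : ℝ) (τ : ℝ≥0∞) : Set X :=
  {x | ∃ r, 0 < r ∧ r ≤ R ∧ τ * μ (Metric.ball x r) < ∫⁻ y in Metric.ball x r, G y ∂μ}

/-- On each selected ball the part of `G` below `τ / 2` accounts for at most half of the mass, so it
is absorbed. Only the tail of `G` remains on the right, which is what gives little-o decay. -/
lemma measure_maximalSuperlevel_le [SecondCountableTopology X] (hμ : IsDoubling μ) {C : ℝ≥0}
    (hC : ∀ (k : ℕ) (x : X) (r : ℝ), 0 < r →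
      μ (Metric.ball x (2 ^ k * r)) ≤ C ^ k * μ (Metric.ball x r))
    {G : X → ℝ≥0∞} (hG : Measurable G) (R : ℝ) {τ : ℝ≥0∞} (hτ : τ ≠ ⊤) :
    τ * μ (maximalSuperlevel μ G R τ) ≤ 2 * C ^ 3 * ∫⁻ x in {x | τ / 2 < G x}, G x ∂μ := by
  set E := maximalSuperlevel μ G R τ with hE
  set S := {x | τ / 2 < G x} with hS
  have hSm : MeasurableSet S := measurableSet_lt measurable_const hG
  have hr : ∀ x : E, ∃ r, 0 < r ∧ r ≤ R ∧
      τ * μ (Metric.ball (x : X) r) < ∫⁻ y in Metric.ball (x : X) r, G y ∂μ := fun x => x.2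
  choose r hr0 hrR hrlt using hr
  obtain ⟨u, -, hdisj, hcov⟩ := Vitali.exists_disjoint_subfamily_covering_enlargement_closedBall
    (univ : Set E) (fun x => (x : X)) r R (fun x _ => hrR x) 5 (by norm_num)
  have hdisj' : u.PairwiseDisjoint fun x : E => Metric.ball (x : X) (r x) :=
    hdisj.mono fun x => Metric.ball_subset_closedBall
  have hu : u.Countable := hdisj'.countable_of_isOpen (fun x _ => Metric.isOpen_ball)
    (fun x _ => ⟨x, Metric.mem_ball_self (hr0 x)⟩)
  have : Countable u := hu.to_subtype
  have hball : ∀ x : E, τ * μ (Metric.ball (x : X) (r x)) ≤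
      2 * ∫⁻ y in Metric.ball (x : X) (r x) ∩ S, G y ∂μ := fun x => by
    set B := Metric.ball (x : X) (r x)
    have hB : μ B ≠ ⊤ := (hμ.1 x _ (hr0 x)).2.ne
    have h1 : ∫⁻ y in B, G y ∂μ ≤ (∫⁻ y in B ∩ S, G y ∂μ) + τ / 2 * μ B := by
      rw [← lintegral_inter_add_sdiff G B hSm]
      gcongr
      calc ∫⁻ y in B \ S, G y ∂μ ≤ ∫⁻ _ in B \ S, τ / 2 ∂μ :=
            setLIntegral_mono' (Metric.isOpen_ball.measurableSet.diff hSm) fun y hy => not_lt.1 hy.2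
        _ ≤ ∫⁻ _ in B, τ / 2 ∂μ := lintegral_mono_set sdiff_subset
        _ = τ / 2 * μ B := by simp
    have h2 : τ / 2 * μ B + τ / 2 * μ B ≤ (∫⁻ y in B ∩ S, G y ∂μ) + τ / 2 * μ B := by
      rw [← add_mul, ENNReal.add_halves]
      exact (hrlt x).le.trans h1
    have h3 := ENNReal.le_of_add_le_add_right
      (ENNReal.mul_ne_top (ENNReal.div_ne_top hτ two_ne_zero) hB) h2
    calc τ * μ B = 2 * (τ / 2 * μ B) := by
          rw [← mul_assoc, ENNReal.mul_div_cancel two_ne_zero ENNReal.ofNat_ne_top]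
      _ ≤ _ := by gcongr
  have hEu : E ⊆ ⋃ x : u, Metric.closedBall ((x : E) : X) (5 * r x) := fun x hx => by
    obtain ⟨b, hb, hsub⟩ := hcov ⟨x, hx⟩ (mem_univ _)
    exact mem_iUnion.2 ⟨⟨b, hb⟩, hsub (Metric.mem_closedBall_self (hr0 _).le)⟩
  calc τ * μ E ≤ τ * ∑' x : u, μ (Metric.closedBall ((x : E) : X) (5 * r x)) := by
        gcongr
        exact (measure_mono hEu).trans (measure_iUnion_le _)
    _ ≤ τ * ∑' x : u, C ^ 3 * μ (Metric.ball ((x : E) : X) (r x)) := by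
        gcongr with x
        -- The fivefold closed ball lies in the ball of radius `2 ^ 3 * r`, whence `C ^ 3`.
        refine (measure_mono (Metric.closedBall_subset_ball ?_)).trans (hC 3 _ _ (hr0 _))
        linarith [hr0 (x : E)]
    _ = C ^ 3 * ∑' x : u, τ * μ (Metric.ball ((x : E) : X) (r x)) := by
        rw [ENNReal.tsum_mul_left, ENNReal.tsum_mul_left]; ring
    _ ≤ C ^ 3 * ∑' x : u, 2 * ∫⁻ y in Metric.ball ((x : E) : X) (r x) ∩ S, G y ∂μ := by
        exact mul_le_mul_right (ENNReal.tsum_le_tsum fun x : u => hball x) _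
    _ = 2 * C ^ 3 * ∫⁻ y in ⋃ x : u, Metric.ball ((x : E) : X) (r x) ∩ S, G y ∂μ := by
        rw [ENNReal.tsum_mul_left, lintegral_iUnion
          (fun x => Metric.isOpen_ball.measurableSet.inter hSm)]
        · ring
        · intro x y hxy
          exact (hdisj' x.2 y.2 fun h => hxy (Subtype.ext h)).mono inter_subset_left
            inter_subset_left
    _ ≤ _ := by
        gcongr
        exact iUnion_subset fun x => inter_subset_right

lemma tendsto_rpow_mul_measure_maximalSuperlevel [SecondCountableTopology X] (hμ : IsDoubling μ)
    {G : X → ℝ≥0∞} (hG : Measurable G) (hGfin : ∫⁻ x, G x ∂μ ≠ ⊤) (R : ℝ) {p : ℝ} (hp : 0 < p) :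
    Tendsto (fun n : ℕ => (n : ℝ≥0∞) ^ p * μ (maximalSuperlevel μ G R ((n : ℝ≥0∞) ^ p))) atTop
      (𝓝 0) := by
  obtain ⟨C, -, hC⟩ := hμ.exists_iterate
  have h1 : Tendsto (fun n : ℕ => (n : ℝ≥0∞) ^ p / 2) atTop (𝓝 ⊤) := by
    have h2 : Tendsto (fun n : ℕ => (n : ℝ≥0∞) ^ p) atTop (𝓝 (⊤ ^ p)) :=
      (ENNReal.continuous_rpow_const.tendsto _).comp ENNReal.tendsto_nat_nhds_top
    rw [ENNReal.top_rpow_of_pos hp] at h2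
    have := ENNReal.Tendsto.div_const h2 (b := 2) (Or.inl ENNReal.top_ne_zero)
    rwa [ENNReal.top_div_of_ne_top (by simp)] at this
  have h3 : Tendsto (fun n : ℕ => μ {x | (n : ℝ≥0∞) ^ p / 2 < G x}) atTop (𝓝 0) := by
    have h4 := ENNReal.Tendsto.const_div (a := ∫⁻ x, G x ∂μ) h1 (Or.inr hGfin)
    rw [ENNReal.div_top] at h4
    refine tendsto_of_tendsto_of_tendsto_of_le_of_le' tendsto_const_nhds h4
      (Eventually.of_forall fun _ => zero_le) ?_
    filter_upwards [eventually_ge_atTop 1] with n hn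
    refine (measure_mono (fun x (hx : (n : ℝ≥0∞) ^ p / 2 < G x) => hx.le :
      {x | (n : ℝ≥0∞) ^ p / 2 < G x} ⊆ {x | (n : ℝ≥0∞) ^ p / 2 ≤ G x})).trans
      (meas_ge_le_lintegral_div hG.aemeasurable ?_ ?_)
    · have : (n : ℝ≥0∞) ^ p ≠ 0 := by
        simp [ENNReal.rpow_eq_zero_iff, hp.not_gt, show n ≠ 0 by omega]
      exact ENNReal.div_ne_zero.2 ⟨this, by simp⟩
    · exact ENNReal.div_ne_top (by finiteness) two_ne_zero
  have h5 := ENNReal.Tendsto.const_mul (a := 2 * (C : ℝ≥0∞) ^ 3)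
    (tendsto_setLIntegral_zero hGfin h3) (Or.inr (by finiteness))
  rw [mul_zero] at h5
  exact tendsto_of_tendsto_of_tendsto_of_le_of_le tendsto_const_nhds h5 (fun _ => zero_le)
    fun n => measure_maximalSuperlevel_le hμ hC hG R (by finiteness)

end WeakType

/-! ### Poincaré inequality and pointwise Lipschitz estimates. -/

section Oscillation

variable {X : Type*} [MetricSpace X] [MeasurableSpace X] {μ : Measure X}

lemma enorm_average_sub_le {X : Type*} [MeasurableSpace X] {μ : Measure X} {w : X → ℝ}
    (hw : Integrable w μ) {s B : Set X} (hsB : s ⊆ B)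
    (hs0 : μ s ≠ 0) (hB : μ B ≠ ⊤) {M : ℝ≥0∞} (hM : μ B ≤ M * μ s) (a : ℝ) :
    ‖(⨍ y in s, w y ∂μ) - a‖ₑ ≤ M * ⨍⁻ y in B, ‖w y - a‖ₑ ∂μ := by
  have hst : μ s ≠ ⊤ := ne_top_of_le_ne_top hB (measure_mono hsB)
  have hB0 : μ B ≠ 0 := fun h => hs0 (measure_mono_null hsB h)
  have : IsFiniteMeasure (μ.restrict s) := ⟨by simpa using hst.lt_top⟩
  have : NeZero (μ.restrict s) := ⟨by simpa using hs0⟩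
  have h1 : (⨍ y in s, w y ∂μ) - a = ⨍ y in s, (w y - a) ∂μ := by
    have h2 : Integrable w (((μ.restrict s) univ)⁻¹ • μ.restrict s) :=
      hw.restrict.smul_measure (by simpa using hs0)
    rw [average, average, integral_sub h2 (integrable_const _), integral_const, probReal_univ, one_smul]
  rw [h1, average]
  refine (enorm_integral_le_lintegral_enorm _).trans ?_
  change ⨍⁻ y in s, ‖w y - a‖ₑ ∂μ ≤ _
  rw [setLAverage_eq, setLAverage_eq, ENNReal.div_eq_inv_mul, ENNReal.div_eq_inv_mul, ← mul_assoc]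
  refine mul_le_mul' ?_ (lintegral_mono_set hsB)
  rw [← div_eq_mul_inv, ENNReal.le_div_iff_mul_le (Or.inl hB0) (Or.inl hB)]
  calc (μ s)⁻¹ * μ B ≤ (μ s)⁻¹ * (M * μ s) := by gcongr
    _ = M := by rw [mul_left_comm, ENNReal.inv_mul_cancel hs0 hst, mul_one]

/-- The `p`-Poincaré inequality with fixed constants. -/
def PoincareWith (p : ℝ) (μ : Measure X) (C lam : ℝ) : Prop :=
  ∀ (x : X) (r : ℝ), 0 < r → ∀ u : X → ℝ, Integrable u μ →
    ∀ g : X → ℝ≥0∞, IsUpperGradient (fun y => (u y : EReal)) g →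
      ⨍⁻ y in Metric.ball x r, ‖u y - ⨍ z in Metric.ball x r, u z ∂μ‖ₑ ∂μ ≤
        ENNReal.ofReal (C * Metric.diam (Metric.ball x r)) *
          (⨍⁻ y in Metric.ball x (lam * r), g y ^ p ∂μ) ^ (1 / p)

variable {p C lam : ℝ} {w : X → ℝ} {g : X → ℝ≥0∞} {D : ℝ≥0} {R : ℝ} {T : ℝ≥0∞}

lemma laverage_rpow_le (hp : 0 < p) {x : X}
    (hx : x ∉ maximalSuperlevel μ (fun y => g y ^ p) R (T ^ p)) {r : ℝ} (hr : 0 < r) (hrR : r ≤ R) :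
    (⨍⁻ y in Metric.ball x r, g y ^ p ∂μ) ^ (1 / p) ≤ T := by
  rw [one_div, ENNReal.rpow_inv_le_iff hp, setLAverage_eq]
  refine ENNReal.div_le_of_le_mul ?_
  by_contra hcon
  exact hx ⟨r, hr, hrR, not_le.1 hcon⟩

/-- Away from the superlevel set of the maximal function, averages over sets that are comparable to
`B(x, r)` differ from the average over `B(x, r)` by at most a multiple of `r T`. -/
lemma edist_average_le (hμ : IsDoubling μ) (hp : 0 < p) (hC : 0 < C) (hlam : 1 ≤ lam)
    (hPI : PoincareWith p μ C lam) (hw : Integrable w μ)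
    (hg : IsUpperGradient (fun y => (w y : EReal)) g) {x : X}
    (hx : x ∉ maximalSuperlevel μ (fun y => g y ^ p) R (T ^ p)) {r : ℝ} (hr : 0 < r)
    (hrR : lam * r ≤ R) {s : Set X} (hs : s ⊆ Metric.ball x r) (hs0 : μ s ≠ 0)
    (hD : μ (Metric.ball x r) ≤ D * μ s) :
    edist (⨍ y in s, w y ∂μ) (⨍ y in Metric.ball x r, w y ∂μ) ≤
      D * (ENNReal.ofReal (2 * C * r) * T) := by
  rw [edist_eq_enorm_sub]
  refine (enorm_average_sub_le hw hs hs0 (hμ.1 x r hr).2.ne hD _).trans ?_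
  gcongr
  refine (hPI x r hr w hw g hg).trans ?_
  refine mul_le_mul' (ENNReal.ofReal_le_ofReal ?_) ?_
  · calc C * Metric.diam (Metric.ball x r) ≤ C * (2 * r) := by
          gcongr; exact Metric.diam_ball hr.le
      _ = 2 * C * r := by ring
  · exact laverage_rpow_le hp hx (by positivity) hrR

lemma edist_average_average_le (hμ : IsDoubling μ) (hp : 0 < p) (hC : 0 < C) (hlam : 1 ≤ lam)
    (hPI : PoincareWith p μ C lam) (hw : Integrable w μ)
    (hg : IsUpperGradient (fun y => (w y : EReal)) g) {x : X}
    (hx : x ∉ maximalSuperlevel μ (fun y => g y ^ p) R (T ^ p)) {r : ℝ} (hr : 0 < r)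
    (hrR : lam * r ≤ R) {s s' : Set X} (hs : s ⊆ Metric.ball x r) (hs0 : μ s ≠ 0)
    (hD : μ (Metric.ball x r) ≤ D * μ s) (hs' : s' ⊆ Metric.ball x r) (hs0' : μ s' ≠ 0)
    (hD' : μ (Metric.ball x r) ≤ D * μ s') :
    edist (⨍ y in s, w y ∂μ) (⨍ y in s', w y ∂μ) ≤ ENNReal.ofReal (4 * C * D * r) * T := by
  have h1 := edist_average_le hμ hp hC hlam hPI hw hg hx hr hrR hs hs0 hD
  have h2 := edist_average_le hμ hp hC hlam hPI hw hg hx hr hrR hs' hs0' hD'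
  rw [edist_comm] at h2
  calc _ ≤ D * (ENNReal.ofReal (2 * C * r) * T) + D * (ENNReal.ofReal (2 * C * r) * T) :=
        (edist_triangle _ _ _).trans (add_le_add h1 h2)
    _ = _ := by
        rw [← two_mul, show (4 : ℝ) * C * D * r = 2 * (D * (2 * C * r)) by ring,
          ENNReal.ofReal_mul zero_le_two, ENNReal.ofReal_mul D.coe_nonneg, ENNReal.ofReal_coe_nnreal,
          ENNReal.ofReal_ofNat]
        ring

/-- Telescoping over radii `r / 2 ^ n`: consecutive means differ by at most `8 * C * D * r * T / 2 ^
n`, with sum `16 * C * D * r * T`. -/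
lemma edist_average_closedBall_le (hμ : IsDoubling μ) (hp : 0 < p) (hC : 0 < C) (hlam : 1 ≤ lam)
    (hPI : PoincareWith p μ C lam)
    (hD : ∀ (x : X) (r : ℝ), 0 < r → μ (Metric.ball x (4 * r)) ≤ D * μ (Metric.closedBall x r))
    (hw : Integrable w μ) (hg : IsUpperGradient (fun y => (w y : EReal)) g) {x : X}
    (hx : x ∉ maximalSuperlevel μ (fun y => g y ^ p) R (T ^ p)) {r : ℝ} (hr : 0 < r)
    (hrR : lam * (2 * r) ≤ R)
    (hL : Tendsto (fun n : ℕ => ⨍ y in Metric.closedBall x (r / 2 ^ n), w y ∂μ) atTop (𝓝 (w x))) :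
    edist (⨍ y in Metric.closedBall x r, w y ∂μ) (w x) ≤ ENNReal.ofReal (16 * C * D * r) * T := by
  have hpos : ∀ (z : X) (r : ℝ), 0 < r → μ (Metric.closedBall z r) ≠ 0 := fun z r hr =>
    ((hμ.1 z r hr).1.trans_le (measure_mono Metric.ball_subset_closedBall)).ne'
  have h := edist_le_of_edist_le_geometric_two_of_tendsto₀ (ENNReal.ofReal (8 * C * D * r) * T)
    (f := fun n : ℕ => ⨍ y in Metric.closedBall x (r / 2 ^ n), w y ∂μ) (fun n => ?_) hL
  · rw [← mul_assoc, ← ENNReal.ofReal_ofNat, ← ENNReal.ofReal_mul zero_le_two] at h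
    convert h using 3
    · simp
    · ring
  set t := r / 2 ^ n with ht
  have ht0 : 0 < t := by positivity
  have htr : t ≤ r := div_le_self hr.le (one_le_pow₀ one_le_two)
  have ht2 : r / 2 ^ (n + 1) = t / 2 := by rw [ht, pow_succ]; field_simp
  simp only [ht2]
  refine (edist_average_average_le hμ hp hC hlam hPI hw hg hx (r := 2 * t) (by positivity)
    ((by gcongr : lam * (2 * t) ≤ lam * (2 * r)).trans hrR) (D := D)
    (Metric.closedBall_subset_ball (by linarith)) (hpos x t ht0) ?_
    (Metric.closedBall_subset_ball (by linarith)) (hpos x _ (by positivity)) ?_).trans ?_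
  · exact (measure_mono (Metric.ball_subset_ball (by linarith))).trans (hD x t ht0)
  · have := hD x (t / 2) (by positivity)
    rwa [show 4 * (t / 2) = 2 * t by ring] at this
  · have h2 : (4 : ℝ) * C * D * (2 * t) = 8 * C * D * r / 2 ^ n := by rw [ht]; ring
    rw [h2, ENNReal.ofReal_div_of_pos (by positivity), ENNReal.ofReal_pow zero_le_two,
      ENNReal.ofReal_ofNat, ENNReal.div_eq_inv_mul, ENNReal.div_eq_inv_mul, mul_assoc]

/-- Off the superlevel set of the maximal function, a function is Lipschitz on its Lebesgue points
at distance at most `1`. -/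
lemma edist_le_of_notMem_maximalSuperlevel (hμ : IsDoubling μ) (hp : 0 < p) (hC : 0 < C)
    (hlam : 1 ≤ lam) (hPI : PoincareWith p μ C lam)
    (hD : ∀ (x : X) (r : ℝ), 0 < r → μ (Metric.ball x (4 * r)) ≤ D * μ (Metric.closedBall x r))
    (hw : Integrable w μ) (hg : IsUpperGradient (fun y => (w y : EReal)) g)
    (hR : lam * 3 ≤ R) {x y : X}
    (hx : x ∉ maximalSuperlevel μ (fun y => g y ^ p) R (T ^ p))
    (hy : y ∉ maximalSuperlevel μ (fun y => g y ^ p) R (T ^ p))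
    (hLx : ∀ r : ℝ, 0 < r →
      Tendsto (fun n : ℕ => ⨍ z in Metric.closedBall x (r / 2 ^ n), w z ∂μ) atTop (𝓝 (w x)))
    (hLy : ∀ r : ℝ, 0 < r →
      Tendsto (fun n : ℕ => ⨍ z in Metric.closedBall y (r / 2 ^ n), w z ∂μ) atTop (𝓝 (w y)))
    (hxy : dist x y ≤ 1) :
    edist (w x) (w y) ≤ ENNReal.ofReal (44 * C * D) * T * edist x y := by
  rcases eq_or_ne x y with rfl | hne
  · simp
  set r := dist x y with hr
  have hr0 : 0 < r := dist_pos.2 hne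
  have hpos : ∀ (z : X) (r : ℝ), 0 < r → μ (Metric.closedBall z r) ≠ 0 := fun z r hr =>
    ((hμ.1 z r hr).1.trans_le (measure_mono Metric.ball_subset_closedBall)).ne'
  have hR2 : lam * (2 * r) ≤ R := le_trans (by gcongr; linarith) hR
  have hR3 : lam * (3 * r) ≤ R := le_trans (by gcongr; linarith) hR
  have h1 := edist_average_closedBall_le hμ hp hC hlam hPI hD hw hg hx hr0 hR2 (hLx r hr0)
  have h2 := edist_average_closedBall_le hμ hp hC hlam hPI hD hw hg hy hr0 hR2 (hLy r hr0)
  have h3 := edist_average_average_le hμ hp hC hlam hPI hw hg hx (r := 3 * r) (by positivity)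
    hR3 (D := D) (s := Metric.closedBall x r) (s' := Metric.closedBall y r)
    (Metric.closedBall_subset_ball (by linarith)) (hpos x r hr0)
    ((measure_mono (Metric.ball_subset_ball (by linarith))).trans (hD x r hr0))
    (fun z hz => by
      rw [Metric.mem_closedBall] at hz
      rw [Metric.mem_ball]
      linarith [dist_triangle z y x, dist_comm x y]) (hpos y r hr0)
    ((measure_mono (Metric.ball_subset_ball' (by linarith))).trans (hD y r hr0))
  rw [edist_comm] at h1
  -- The constant is `44 = 16 + 12 + 16`: one telescoping chain at each point and one comparison of
  -- means inside `B(x, 3r)`.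
  calc edist (w x) (w y) ≤ ENNReal.ofReal (16 * C * D * r) * T +
        ENNReal.ofReal (4 * C * D * (3 * r)) * T + ENNReal.ofReal (16 * C * D * r) * T :=
        (edist_triangle4 _ _ _ _).trans (add_le_add (add_le_add h1 h3) h2)
    _ = ENNReal.ofReal (44 * C * D * r) * T := by
        rw [← add_mul, ← add_mul, ← ENNReal.ofReal_add (by positivity) (by positivity),
          ← ENNReal.ofReal_add (by positivity) (by positivity)]
        ring_nf
    _ = _ := by
        rw [ENNReal.ofReal_mul (by positivity), edist_dist, ← hr]; ring

end Oscillation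

/-! ### Lipschitz approximation in the Newtonian norm. -/

section Approximation

variable {X : Type*} [MetricSpace X] [MeasurableSpace X] {μ : Measure X}

lemma IsDoubling.isUnifLocDoublingMeasure (h : IsDoubling μ) : IsUnifLocDoublingMeasure μ := by
  obtain ⟨C, -, hC⟩ := h.exists_iterate
  refine ⟨C ^ 2, ?_⟩
  filter_upwards [self_mem_nhdsWithin] with r hr x
  have hr : 0 < r := hr
  calc μ (Metric.closedBall x (2 * r)) ≤ μ (Metric.ball x (2 ^ 2 * r)) :=
        measure_mono (Metric.closedBall_subset_ball (by linarith))
    _ ≤ C ^ 2 * μ (Metric.ball x r) := hC 2 x r hr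
    _ ≤ _ := by
        push_cast
        gcongr
        exact Metric.ball_subset_closedBall

lemma ae_tendsto_average_closedBall [BorelSpace X] [SecondCountableTopology X] [IsLocallyFiniteMeasure μ]
    (h : IsDoubling μ) {w : X → ℝ} (hw : Integrable w μ) : ∀ᵐ x ∂μ, ∀ r : ℝ, 0 < r →
      Tendsto (fun n : ℕ => ⨍ y in Metric.closedBall x (r / 2 ^ n), w y ∂μ) atTop (𝓝 (w x)) := by
  have := h.isUnifLocDoublingMeasure
  filter_upwards [IsUnifLocDoublingMeasure.ae_tendsto_average μ hw.locallyIntegrable 1] with x hx r hr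
  refine hx (fun _ => x) (fun n : ℕ => r / 2 ^ n) ?_ ?_
  · refine tendsto_nhdsWithin_iff.2 ⟨?_, Eventually.of_forall fun n => by
      simp only [mem_Ioi]; positivity⟩
    have := (tendsto_pow_atTop_nhds_zero_of_lt_one (r := (2 : ℝ)⁻¹) (by norm_num)
      (by norm_num)).const_mul r
    simpa [div_eq_mul_inv] using this
  · exact Eventually.of_forall fun n => Metric.mem_closedBall_self (by positivity)

lemma add_rpow_le_two_rpow_mul {p : ℝ} (hp : 0 < p) (a b : ℝ≥0∞) :
    (a + b) ^ p ≤ 2 ^ p * (a ^ p + b ^ p) := by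
  have h1 : a + b ≤ 2 * max a b := by
    rw [two_mul]; exact add_le_add (le_max_left _ _) (le_max_right _ _)
  calc (a + b) ^ p ≤ (2 * max a b) ^ p := by gcongr
    _ = 2 ^ p * (max a b) ^ p := ENNReal.mul_rpow_of_nonneg _ _ hp.le
    _ ≤ _ := by
        gcongr
        rw [(ENNReal.monotone_rpow_of_nonneg hp.le).map_max]
        exact max_le le_self_add le_add_self

lemma exists_lipschitz_eq_off [BorelSpace X] [SecondCountableTopology X] [IsLocallyFiniteMeasure μ] {p C lam : ℝ}
    (hμ : IsDoubling μ) (hp : 0 < p) (hC : 0 < C) (hlam : 1 ≤ lam) (hPI : PoincareWith p μ C lam)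
    {w : X → ℝ} {g : X → ℝ≥0∞} (hw : Integrable w μ) (hw1 : ∀ x, w x ∈ Icc (-1 : ℝ) 1)
    (hg : IsUpperGradient (fun y => (w y : EReal)) g) : ∃ K : ℝ≥0, ∀ n : ℕ, 1 ≤ n →
      ∃ (L : X → ℝ) (N : Set X), LipschitzWith (K * n) L ∧ (∀ x, L x ∈ Icc (-1 : ℝ) 1) ∧
        MeasurableSet N ∧ μ N = 0 ∧
        ∀ x ∉ toMeasurable μ (maximalSuperlevel μ (fun y => g y ^ p) (lam * 3) ((n : ℝ≥0∞) ^ p)) ∪ N,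
          w x = L x := by
  obtain ⟨D', -, hD'⟩ := hμ.exists_iterate
  have hD : ∀ (x : X) (r : ℝ), 0 < r →
      μ (Metric.ball x (4 * r)) ≤ (D' ^ 2 : ℝ≥0) * μ (Metric.closedBall x r) := fun x r hr => by
    have := hD' 2 x r hr
    rw [show (2 : ℝ) ^ 2 = 4 by norm_num] at this
    refine this.trans ?_
    push_cast
    gcongr
    exact Metric.ball_subset_closedBall
  set D : ℝ≥0 := D' ^ 2
  -- The summand `2` handles points at distance at least `1`, where `|w| ≤ 1` alone bounds the
  -- increment.
  set K : ℝ≥0 := Real.toNNReal (44 * C * D) + 2 with hK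
  refine ⟨K, fun n hn => ?_⟩
  set P : Set X := {x | ∀ r : ℝ, 0 < r →
    Tendsto (fun n : ℕ => ⨍ y in Metric.closedBall x (r / 2 ^ n), w y ∂μ) atTop (𝓝 (w x))} with hP
  have hP0 : μ Pᶜ = 0 := ae_tendsto_average_closedBall hμ hw
  set E := maximalSuperlevel μ (fun y => g y ^ p) (lam * 3) ((n : ℝ≥0∞) ^ p)
  have hn1 : (1 : ℝ≥0∞) ≤ n := by exact_mod_cast hn
  have hlip : LipschitzOnWith (K * n) w (Eᶜ ∩ P) := by
    rintro x ⟨hxE, hxP⟩ y ⟨hyE, hyP⟩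
    rcases le_total (dist x y) 1 with hd | hd
    · refine (edist_le_of_notMem_maximalSuperlevel hμ hp hC hlam hPI hD hw hg le_rfl hxE hyE
        hxP hyP hd).trans ?_
      push_cast [hK]
      gcongr
      exact le_self_add
    · calc edist (w x) (w y) ≤ 2 := by
            rw [edist_dist, Real.dist_eq]
            refine ENNReal.ofReal_le_of_le_toReal ?_
            simp only [ENNReal.toReal_ofNat]
            rw [abs_le]
            constructor <;> linarith [(hw1 x).1, (hw1 x).2, (hw1 y).1, (hw1 y).2]
        _ = 2 * 1 * 1 := by simp
        _ ≤ K * n * edist x y := by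
            gcongr
            · rw [hK]; push_cast; exact le_add_self
            · rw [edist_dist]; simpa using ENNReal.ofReal_le_ofReal hd
        _ = _ := by push_cast; rfl
  obtain ⟨L, hL, hLw⟩ := hlip.extend_real
  refine ⟨fun x => max (-1) (min 1 (L x)), toMeasurable μ Pᶜ, (hL.const_min 1).const_max (-1),
    fun x => ⟨le_max_left _ _, max_le (by norm_num) (min_le_left _ _)⟩,
    measurableSet_toMeasurable _ _, by rw [measure_toMeasurable, hP0], fun x hx => ?_⟩
  have hxE : x ∈ Eᶜ := fun h => hx (Or.inl (subset_toMeasurable _ _ h))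
  have hxP : x ∈ P := by
    by_contra h
    exact hx (Or.inr (subset_toMeasurable _ _ h))
  beta_reduce
  rw [← hLw ⟨hxE, hxP⟩, min_eq_right (hw1 x).2, max_eq_right (hw1 x).1]

/-- Bounded functions with a `p`-integrable upper gradient are approximated by continuous functions
in the Newtonian norm. -/
lemma exists_continuous_approx [BorelSpace X] [SecondCountableTopology X] [IsLocallyFiniteMeasure μ] {p C lam : ℝ}
    (hμ : IsDoubling μ) (hp : 0 < p) (hC : 0 < C) (hlam : 1 ≤ lam) (hPI : PoincareWith p μ C lam)
    {w : X → ℝ} {g : X → ℝ≥0∞} (hw : Integrable w μ) (hw1 : ∀ x, w x ∈ Icc (-1 : ℝ) 1)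
    (hg : IsUpperGradient (fun y => (w y : EReal)) g) (hgp : ∫⁻ x, g x ^ p ∂μ ≠ ⊤) {ε : ℝ≥0∞}
    (hε : ε ≠ 0) : ∃ (L : X → ℝ) (h : X → ℝ≥0∞), Continuous L ∧
      IsUpperGradient (fun y => ((w y - L y : ℝ) : EReal)) h ∧
      ∫⁻ x, ‖w x - L x‖ₑ ^ p ∂μ + ∫⁻ x, h x ^ p ∂μ ≤ ε := by
  obtain ⟨K, hK⟩ := exists_lipschitz_eq_off hμ hp hC hlam hPI hw hw1 hg
  set E : ℕ → Set X := fun n => toMeasurable μ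
    (maximalSuperlevel μ (fun y => g y ^ p) (lam * 3) ((n : ℝ≥0∞) ^ p)) with hE
  set a : ℕ → ℝ≥0∞ := fun n => (n : ℝ≥0∞) ^ p * μ (E n) with ha
  have ha0 : Tendsto a atTop (𝓝 0) := by
    simp only [ha, hE, measure_toMeasurable]
    exact tendsto_rpow_mul_measure_maximalSuperlevel hμ (hg.1.pow_const p) hgp _ hp
  have hμa : ∀ n, 1 ≤ n → μ (E n) ≤ a n := fun n hn => by
    refine le_mul_of_one_le_left zero_le (ENNReal.one_le_rpow (by exact_mod_cast hn) hp)
  have hμE : Tendsto (fun n => μ (E n)) atTop (𝓝 0) :=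
    tendsto_of_tendsto_of_tendsto_of_le_of_le' tendsto_const_nhds ha0
      (Eventually.of_forall fun _ => zero_le) (by
        filter_upwards [eventually_ge_atTop 1] with n hn using hμa n hn)
  -- `b n` bounds the function and gradient terms of the error at level `n`. The factor `(n⁻¹)^p`
  -- comes from taking `δ = n⁻¹` in the glued gradient.
  set b : ℕ → ℝ≥0∞ := fun n => 2 ^ p * a n + 2 ^ p * (2 ^ p * ((∫⁻ x in E n, g x ^ p ∂μ) +
    K ^ p * a n) + ((n : ℝ≥0∞)⁻¹) ^ p * ∫⁻ x, g x ^ p ∂μ) with hb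
  have hb0 : Tendsto b atTop (𝓝 0) := by
    have h1 := tendsto_setLIntegral_zero hgp hμE
    have h2 : Tendsto (fun n : ℕ => ((n : ℝ≥0∞)⁻¹) ^ p) atTop (𝓝 0) := by
      have := (ENNReal.continuous_rpow_const (y := p)).tendsto 0 |>.comp
        ENNReal.tendsto_inv_nat_nhds_zero
      rwa [ENNReal.zero_rpow_of_pos hp] at this
    have h3 := ENNReal.Tendsto.const_mul (a := (2 : ℝ≥0∞) ^ p) ha0 (Or.inr (by finiteness))
    have h4 := ENNReal.Tendsto.const_mul (a := (K : ℝ≥0∞) ^ p) ha0 (Or.inr (by finiteness))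
    have h5 := ENNReal.Tendsto.mul_const (b := ∫⁻ x, g x ^ p ∂μ) h2 (Or.inr hgp)
    have h6 := ENNReal.Tendsto.const_mul (a := (2 : ℝ≥0∞) ^ p) (h1.add h4) (Or.inr (by finiteness))
    have h7 := ENNReal.Tendsto.const_mul (a := (2 : ℝ≥0∞) ^ p) (h6.add h5) (Or.inr (by finiteness))
    simpa using h3.add h7
  obtain ⟨n, hn, hn1⟩ := ((hb0.eventually (gt_mem_nhds (pos_iff_ne_zero.2 hε))).and
    (eventually_ge_atTop 1)).exists
  obtain ⟨L, N, hL, hL1, hNm, hN0, heq⟩ := hK n hn1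
  have hEm : MeasurableSet (E n) := measurableSet_toMeasurable _ _
  refine ⟨L, _, hL.continuous, isUpperGradient_sub_of_eq_off hg hL hEm hNm heq
    (δ := (n : ℝ≥0∞)⁻¹) (by simp), le_trans (add_le_add ?_ ?_) hn.le⟩
  · calc ∫⁻ x, ‖w x - L x‖ₑ ^ p ∂μ ≤ ∫⁻ x, (E n).indicator (fun _ => 2 ^ p) x ∂μ := by
          refine lintegral_mono_ae ?_
          filter_upwards [measure_eq_zero_iff_ae_notMem.1 hN0] with x hx
          by_cases hxE : x ∈ E n
          · rw [indicator_of_mem hxE]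
            gcongr
            rw [Real.enorm_eq_ofReal_abs]
            refine ENNReal.ofReal_le_of_le_toReal ?_
            simp only [ENNReal.toReal_ofNat]
            rw [abs_le]
            constructor <;> linarith [(hw1 x).1, (hw1 x).2, (hL1 x).1, (hL1 x).2]
          · rw [heq x (fun h => h.elim hxE hx)]
            simp [hp]
      _ = 2 ^ p * μ (E n) := by rw [lintegral_indicator hEm]; simp
      _ ≤ _ := by gcongr; exact hμa n hn1
  · set κ : ℝ≥0 := K * n
    have h1 : ∫⁻ x, ((E n).indicator (fun x => g x + κ) x + N.indicator ⊤ x +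
        (n : ℝ≥0∞)⁻¹ * g x) ^ p ∂μ ≤ ∫⁻ x, 2 ^ p * ((E n).indicator
          (fun x => 2 ^ p * (g x ^ p + κ ^ p)) x + ((n : ℝ≥0∞)⁻¹) ^ p * g x ^ p) ∂μ := by
      refine lintegral_mono_ae ?_
      filter_upwards [measure_eq_zero_iff_ae_notMem.1 hN0] with x hx
      rw [indicator_of_notMem hx, add_zero]
      refine (add_rpow_le_two_rpow_mul hp _ _).trans ?_
      rw [ENNReal.mul_rpow_of_nonneg _ _ hp.le]
      gcongr
      by_cases hxE : x ∈ E n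
      · rw [indicator_of_mem hxE, indicator_of_mem hxE]
        exact add_rpow_le_two_rpow_mul hp _ _
      · simp [hxE, hp]
    refine h1.trans (le_of_eq ?_)
    rw [lintegral_const_mul' _ _ (by finiteness), lintegral_add_right _
      ((hg.1.pow_const p).const_mul _), lintegral_indicator hEm,
      lintegral_const_mul' _ _ (by finiteness), lintegral_add_right _ measurable_const,
      lintegral_const_mul _ (hg.1.pow_const p)]
    simp only [lintegral_const, Measure.restrict_apply, MeasurableSet.univ, univ_inter, κ, ha]
    push_cast
    rw [ENNReal.mul_rpow_of_nonneg _ _ hp.le, mul_assoc]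

end Approximation

lemma exists_mem_Icc_of_ae {P : ℝ → Prop} {l : ℝ} (hl : 0 < l)
    (h : ∀ᵐ t ∂(volume.restrict (Icc 0 l)), P t) : ∃ t ∈ Icc 0 l, P t := by
  have : (ae (volume.restrict (Icc 0 l))).NeBot := by
    rw [ae_neBot, Ne, Measure.restrict_eq_zero]
    simp [hl]
  exact ((ae_restrict_mem measurableSet_Icc).and h).exists

/-! ### Dirichlet functions with a zero set of positive capacity are finite almost everywhere. -/

section InfiniteValues

variable {X : Type*} [MetricSpace X] [MeasurableSpace X] {μ : Measure X} {p : ℝ}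

lemma lineIntegral_eq_top_of_abs_eq_top {u : X → EReal} {g : X → ℝ≥0∞} (hg : IsUpperGradient u g)
    {γ : ℝ → X} {l : ℝ} (hl : 0 < l) (hγ : HasUnitSpeedOn γ (Icc 0 l)) {t : ℝ} (ht : t ∈ Icc 0 l)
    (hu : (u (γ t)).abs = ⊤) : lineIntegral g γ l = ⊤ := by
  have habs : ∀ a b : EReal, a.abs = ⊤ → (a - b).abs = ⊤ ∧ (b - a).abs = ⊤ := fun a b ha => by
    induction a with
    | bot => induction b <;> simp
    | top => induction b <;> simp
    | coe a => exact absurd ha (EReal.abs_coe_lt_top a).ne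
  rw [← top_le_iff]
  rcases ht.2.eq_or_lt with rfl | htl
  · rw [← (habs _ (u (γ 0)) hu).2]
    exact hg.2 _ γ hl hγ
  · rw [← (habs _ (u (γ l)) hu).1]
    exact (hg.abs_sub_le hγ ht.1 htl le_rfl).trans
      (lintegral_mono_set (Icc_subset_Icc_left ht.1))

/-- Every nonconstant curve through `B` has infinite `g`-length, so the multiple `ε` can be
arbitrarily small. -/
lemma isUpperGradient_indicator_of_abs_eq_top {u : X → EReal} {g : X → ℝ≥0∞}
    (hg : IsUpperGradient u g) {B : Set X} (hB : ∀ x ∈ B, (u x).abs = ⊤) {ε : ℝ≥0∞} (hε : ε ≠ 0) :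
    IsUpperGradient (fun x => ((B.indicator 1 x : ℝ) : EReal)) (fun x => ε * g x) := by
  refine isUpperGradient_coe_iff.2 ⟨hg.1.const_mul _, fun l γ hl hγ => ?_⟩
  have key : ∀ t ∈ Icc 0 l, γ t ∈ B → lineIntegral (fun x => ε * g x) γ l = ⊤ := fun t ht hB' => by
    refine top_le_iff.1 (le_trans ?_ (lintegral_const_mul_le _ _))
    have := lineIntegral_eq_top_of_abs_eq_top hg hl hγ ht (hB _ hB')
    rw [lineIntegral] at this
    rw [this, ENNReal.mul_top hε]
  by_cases h0 : γ 0 ∈ B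
  · rw [key 0 (left_mem_Icc.2 hl.le) h0]; exact le_top
  by_cases h1 : γ l ∈ B
  · rw [key l (right_mem_Icc.2 hl.le) h1]; exact le_top
  simp [h0, h1]

/-- By the Poincaré inequality, the set of points that are not reached by curves of finite
`g`-length is null or of full measure in each ball. -/
lemma measure_inter_ball_eq_zero_or [BorelSpace X] {C lam : ℝ} (hμ : IsDoubling μ) (hp : 0 < p)
    (hlam : 1 ≤ lam) (hPI : PoincareWith p μ C lam)
    {u : X → EReal} {g : X → ℝ≥0∞} (hu : AEMeasurable u μ) (hg : IsUpperGradient u g)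
    (hgp : ∫⁻ x, g x ^ p ∂μ ≠ ⊤) (x : X) {r : ℝ} (hr : 0 < r) :
    μ ({y | (u y).abs = ⊤} ∩ Metric.ball x r) = 0 ∨
      μ (Metric.ball x r \ {y | (u y).abs = ⊤}) = 0 := by
  set A := {y | (u y).abs = ⊤} with hA
  set B := Metric.ball x r with hB
  have hAm : NullMeasurableSet A μ :=
    (measurable_ereal_abs.comp_aemeasurable hu).nullMeasurableSet_preimage (measurableSet_singleton ⊤)
  have hBm : MeasurableSet B := Metric.isOpen_ball.measurableSet
  have hABm : NullMeasurableSet (A ∩ B) μ := hAm.inter hBm.nullMeasurableSet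
  set ψ : X → ℝ := (A ∩ B).indicator 1 with hψ
  have hBfin := hμ.1 x r hr
  have hψm : AEMeasurable ψ μ := (aemeasurable_const (b := (1 : ℝ))).indicator₀ hABm
  have hint : Integrable ψ μ := by
    refine Integrable.mono' (g := B.indicator fun _ => (1 : ℝ)) ?_ hψm.aestronglyMeasurable ?_
    · exact (integrable_indicator_iff hBm).2 (integrableOn_const hBfin.2.ne)
    · refine Eventually.of_forall fun y => ?_
      by_cases h1 : y ∈ B <;> by_cases h2 : y ∈ A <;> simp [hψ, h1, h2]
  set c := ⨍ z in B, ψ z ∂μ with hc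
  -- Applying Poincaré with gradient `g / n` and letting `n → ∞` shows that the indicator equals its
  -- mean almost everywhere on the ball.
  have hzero : ⨍⁻ y in B, ‖ψ y - c‖ₑ ∂μ = 0 := by
    set M : ℝ≥0∞ := ENNReal.ofReal (C * Metric.diam B) *
      (⨍⁻ y in Metric.ball x (lam * r), g y ^ p ∂μ) ^ (1 / p) with hM
    have hMt : M ≠ ⊤ := by
      refine ENNReal.mul_ne_top ENNReal.ofReal_ne_top
        (ENNReal.rpow_ne_top_of_nonneg (by positivity) ?_)
      rw [setLAverage_eq]
      exact ENNReal.div_ne_top (ne_top_of_le_ne_top hgp (setLIntegral_le_lintegral _ _))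
        (hμ.1 x _ (by positivity)).1.ne'
    have hle : ∀ n : ℕ, ⨍⁻ y in B, ‖ψ y - c‖ₑ ∂μ ≤ ((n : ℝ≥0∞)⁻¹) * M := fun n => by
      -- For `n = 0` the inverse is `⊤`, so the bound is trivial unless `M = 0`, where the gradient
      -- `g` itself suffices.
      rcases Nat.eq_zero_or_pos n with rfl | hn
      · by_cases hM0 : M = 0
        · have := hPI x r hr ψ hint _ (isUpperGradient_indicator_of_abs_eq_top hg
            (fun y (hy : y ∈ A ∩ B) => hy.1) one_ne_zero)
          simp only [one_mul] at this
          refine this.trans ?_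
          rw [← hB, ← hM, hM0]
          exact zero_le
        · simp [ENNReal.top_mul hM0]
      have hn' : ((n : ℝ≥0∞)⁻¹) ≠ ⊤ := by simp [hn.ne']
      refine (hPI x r hr ψ hint _ (isUpperGradient_indicator_of_abs_eq_top hg
        (fun y (hy : y ∈ A ∩ B) => hy.1) (ε := (n : ℝ≥0∞)⁻¹) (by simp))).trans (le_of_eq ?_)
      simp only [ENNReal.mul_rpow_of_nonneg _ _ hp.le]
      rw [setLAverage_eq, lintegral_const_mul' _ _ (by finiteness), mul_div_assoc, ← setLAverage_eq,
        ENNReal.mul_rpow_of_nonneg _ _ (by positivity), one_div, ENNReal.rpow_rpow_inv hp.ne', hM,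
        one_div]
      ring
    have hlim := ENNReal.Tendsto.mul_const (b := M) ENNReal.tendsto_inv_nat_nhds_zero (Or.inr hMt)
    rw [zero_mul] at hlim
    exact le_antisymm (ge_of_tendsto' hlim hle) zero_le
  rw [setLAverage_eq, ENNReal.div_eq_zero_iff, or_iff_left hBfin.2.ne,
    lintegral_eq_zero_iff' (hψm.restrict.sub_const c).enorm] at hzero
  rw [Filter.EventuallyEq, ae_restrict_iff' hBm] at hzero
  by_cases hc0 : c = 0
  · left
    rw [measure_eq_zero_iff_ae_notMem]
    filter_upwards [hzero] with y hy hyA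
    have := hy hyA.2
    simp [hψ, hyA, hc0] at this
  · right
    rw [measure_eq_zero_iff_ae_notMem]
    filter_upwards [hzero] with y hy hyA
    have := hy hyA.1
    simp [hψ, hyA.2, hc0] at this

/-- If `A` had positive measure, the dichotomy on growing balls would make `Aᶜ` null. Every
nonconstant curve would then have infinite length for `g + ∞ · 1_N`, with `N` a null hull of `Aᶜ`.
So `Aᶜ`, which contains `S`, would have zero capacity. -/
lemma measure_abs_eq_top [ProperSpace X] [BorelSpace X] [IsLocallyFiniteMeasure μ] {C lam : ℝ}
    (hμ : IsDoubling μ) (hp : 0 < p) (hlam : 1 ≤ lam) (hPI : PoincareWith p μ C lam)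
    {u : X → EReal} {g : X → ℝ≥0∞} (hu : AEMeasurable u μ) (hg : IsUpperGradient u g)
    (hgp : ∫⁻ x, g x ^ p ∂μ ≠ ⊤) {S : Set X} (hS : 0 < sobolevCapacity p μ S)
    (huS : ∀ x ∈ S, u x = 0) : μ {y | (u y).abs = ⊤} = 0 := by
  set A := {y | (u y).abs = ⊤} with hA
  by_contra hA0
  obtain ⟨x⟩ : Nonempty X := by
    by_contra hemp
    rw [not_nonempty_iff] at hemp
    exact hA0 (by rw [Set.eq_empty_of_isEmpty A, measure_empty])
  have hcover : ∀ s : Set X, s ⊆ ⋃ n : ℕ, s ∩ Metric.ball x (n + 1) := fun s y hy => by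
    obtain ⟨n, hn⟩ := exists_nat_gt (dist y x)
    exact mem_iUnion.2 ⟨n, hy, by rw [Metric.mem_ball]; linarith⟩
  obtain ⟨n, hn⟩ : ∃ n : ℕ, μ (A ∩ Metric.ball x (n + 1)) ≠ 0 := by
    by_contra! hcon
    exact hA0 (measure_mono_null (hcover A) (measure_iUnion_null hcon))
  have hcompl : μ Aᶜ = 0 := by
    refine measure_mono_null (hcover Aᶜ) (measure_iUnion_null fun m => ?_)
    have h1 := measure_inter_ball_eq_zero_or hμ hp hlam hPI hu hg hgp x
      (r := (max n m : ℕ) + 1) (by positivity)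
    have hball : ∀ k : ℕ, k ≤ max n m →
        Metric.ball x ((k : ℝ) + 1) ⊆ Metric.ball x ((max n m : ℕ) + 1) := fun k hk =>
      Metric.ball_subset_ball (by gcongr)
    rcases h1 with h1 | h1
    · exact absurd (measure_mono_null (inter_subset_inter_right _ (hball n (le_max_left _ _))) h1) hn
    · refine measure_mono_null ?_ h1
      exact fun y hy => ⟨hball m (le_max_right _ _) hy.2, hy.1⟩
  set N := toMeasurable μ Aᶜ
  have hN0 : μ N = 0 := by rw [measure_toMeasurable, hcompl]
  have hm : Measurable fun y => g y + N.indicator ⊤ y :=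
    hg.1.add (Measurable.indicator measurable_const (measurableSet_toMeasurable _ _))
  refine hS.ne' (le_antisymm (le_of_forall_gt_imp_ge_of_dense fun ε hε => ?_) zero_le)
  have hgp' : ∫⁻ y, (g y + N.indicator ⊤ y) ^ p ∂μ < ⊤ := by
    refine lt_of_le_of_lt (lintegral_mono_ae ?_) hgp.lt_top
    filter_upwards [measure_eq_zero_iff_ae_notMem.1 hN0] with y hy
    simp [hy]
  have hex : ∀ (l : ℝ) (γ : ℝ → X), 0 < l → HasUnitSpeedOn γ (Icc 0 l) → γ 0 ∈ Aᶜ →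
      lineIntegral (fun y => g y + N.indicator ⊤ y) γ l = ⊤ := by
    intro l γ hl hγ _
    by_contra hfin
    obtain ⟨t, ht, htN⟩ := exists_mem_Icc_of_ae hl
      (ae_notMem_of_lineIntegral_ne_top hγ (N := N) hm (fun y hy => by simp [hy]) hfin)
    have htA : γ t ∈ A := by
      by_contra h
      exact htN (subset_toMeasurable _ _ h)
    refine hfin (top_le_iff.1 ?_)
    rw [← lineIntegral_eq_top_of_abs_eq_top hg hl hγ ht htA]
    exact lintegral_mono fun _ => le_self_add
  obtain ⟨O, -, hO, hcap⟩ := exists_isOpen_sobolevCapacity_le hp hcompl hm hgp' hex (ne_of_gt hε)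
  refine (sobolevCapacity_mono (fun y hy => hO ?_)).trans hcap
  simp [hA, huS y hy]

end InfiniteValues

/-! ### Quasicontinuity of bounded integrable functions. -/

section Quasicontinuity

variable {X : Type*} [MetricSpace X] [MeasurableSpace X] {μ : Measure X} {p : ℝ}

lemma sobolevCapacity_superlevel_le (hp : 0 < p) {v : X → ℝ} {g : X → ℝ≥0∞} (hv : AEMeasurable v μ)
    (hg : IsUpperGradient (fun x => (v x : EReal)) g) {K : ℝ≥0} (hK : K ≠ 0) :
    sobolevCapacity p μ {x | 1 ≤ (K : ℝ≥0∞) * ‖v x‖ₑ} ≤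
      K ^ p * (∫⁻ x, ‖v x‖ₑ ^ p ∂μ + ∫⁻ x, g x ^ p ∂μ) := by
  have hKt : (K : ℝ≥0∞) ^ p ≠ ⊤ := (ENNReal.rpow_lt_top_of_nonneg hp.le ENNReal.coe_ne_top).ne
  refine (sobolevCapacity_le hp ((measurable_truncAbs K).comp_aemeasurable
    (measurable_coe_real_ereal.comp_aemeasurable hv)) (hg.comp (edist_truncAbs_le hK)) ?_).trans ?_
  · intro x hx
    refine (truncAbs_eq_one ?_).ge
    rw [Function.comp_apply, abs_coe_eq_enorm]
    exact hx
  · rw [mul_add, ← lintegral_const_mul' _ _ hKt, ← lintegral_const_mul' _ _ hKt]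
    simp only [ENNReal.mul_rpow_of_nonneg _ _ hp.le, Function.comp_apply]
    gcongr with x
    rw [ofReal_truncAbs, ← ENNReal.mul_rpow_of_nonneg _ _ hp.le, abs_coe_eq_enorm]
    gcongr
    exact min_le_right _ _

/-- Approximants that converge fast in the Newtonian norm converge pointwise outside open sets of
arbitrarily small capacity. -/
lemma exists_isOpen_tendsto [ProperSpace X] [BorelSpace X] [IsLocallyFiniteMeasure μ]
    (hp : 0 < p) {v : ℕ → X → ℝ} {h : ℕ → X → ℝ≥0∞} (hv : ∀ k, AEMeasurable (v k) μ)
    (hh : ∀ k, IsUpperGradient (fun x => (v k x : EReal)) (h k)) {e : ℕ → ℝ≥0∞}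
    (he : ∑' k, e k ≠ ⊤)
    (hb : ∀ k, (2 ^ k) ^ p * (∫⁻ x, ‖v k x‖ₑ ^ p ∂μ + ∫⁻ x, h k x ^ p ∂μ) ≤ e k)
    {ε : ℝ≥0∞} (hε : ε ≠ 0) : ∃ O, IsOpen O ∧ sobolevCapacity p μ O ≤ ε ∧
      ∀ x ∉ O, Tendsto (fun k => ‖v k x‖ₑ) atTop (𝓝 0) := by
  set Z : Set X := {x | ¬ Tendsto (fun k => ‖v k x‖ₑ) atTop (𝓝 0)} with hZ
  have htwo : ∀ k : ℕ, (1 : ℝ≥0∞) ≤ (2 ^ k) ^ p := fun k =>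
    ENNReal.one_le_rpow (one_le_pow₀ one_le_two) hp
  have hZ0 : μ Z = 0 := by
    have h1 : ∫⁻ x, ∑' k, ‖v k x‖ₑ ^ p ∂μ ≠ ⊤ := by
      rw [lintegral_tsum fun k => (hv k).enorm.pow_const p]
      refine ne_top_of_le_ne_top he (ENNReal.tsum_le_tsum fun k => le_trans ?_ (hb k))
      exact le_self_add.trans (le_mul_of_one_le_left zero_le (htwo k))
    rw [measure_eq_zero_iff_ae_notMem]
    filter_upwards [ae_lt_top' (AEMeasurable.tsum
      fun k => (hv k).enorm.pow_const p) h1] with x hx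
    have h2 := ENNReal.tendsto_atTop_zero_of_tsum_ne_top hx.ne
    have h3 := ((ENNReal.continuous_rpow_const (y := p⁻¹)).tendsto 0).comp h2
    rw [ENNReal.zero_rpow_of_pos (inv_pos.2 hp)] at h3
    simpa [hZ, Function.comp_def, ENNReal.rpow_rpow_inv hp.ne'] using h3
  set N := toMeasurable μ Z
  have hN0 : μ N = 0 := by rw [measure_toMeasurable, hZ0]
  -- A curve of finite `g`-length has a point off `N`, where `v k → 0`; along it `v k` varies by at
  -- most `2⁻¹ ^ k` times that length. Convergence thus carries over to the starting point.
  set g : X → ℝ≥0∞ := fun x => (⨆ k, 2 ^ k * h k x) + N.indicator ⊤ x with hg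
  have hgm : Measurable g := (Measurable.iSup fun k => (hh k).1.const_mul _).add
    (Measurable.indicator measurable_const (measurableSet_toMeasurable _ _))
  have hgp : ∫⁻ x, g x ^ p ∂μ < ⊤ := by
    calc ∫⁻ x, g x ^ p ∂μ ≤ ∫⁻ x, ∑' k, (2 ^ k) ^ p * h k x ^ p ∂μ := by
          refine lintegral_mono_ae ?_
          filter_upwards [measure_eq_zero_iff_ae_notMem.1 hN0] with x hx
          simp only [hg, indicator_of_notMem hx, add_zero]
          refine (iSup_rpow_le_tsum hp _).trans (le_of_eq ?_)
          simp only [ENNReal.mul_rpow_of_nonneg _ _ hp.le]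
      _ = ∑' k, (2 ^ k) ^ p * ∫⁻ x, h k x ^ p ∂μ := by
          rw [lintegral_tsum fun k => (((hh k).1.pow_const p).const_mul _).aemeasurable]
          congr 1 with k
          rw [lintegral_const_mul _ ((hh k).1.pow_const p)]
      _ ≤ ∑' k, e k := ENNReal.tsum_le_tsum fun k => le_trans (by gcongr; exact le_add_self) (hb k)
      _ < ⊤ := he.lt_top
  have hex : ∀ (l : ℝ) (γ : ℝ → X), 0 < l → HasUnitSpeedOn γ (Icc 0 l) → γ 0 ∈ Z →
      lineIntegral g γ l = ⊤ := by
    intro l γ hl hγ h0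
    by_contra hfin
    obtain ⟨t, ht, htN⟩ := exists_mem_Icc_of_ae hl
      (ae_notMem_of_lineIntegral_ne_top hγ (N := N) hgm (fun y hy => by simp [hg, hy]) hfin)
    have htZ : Tendsto (fun k => ‖v k (γ t)‖ₑ) atTop (𝓝 0) := by
      by_contra hcon
      exact htN (subset_toMeasurable _ _ hcon)
    refine h0 ?_
    have hle : ∀ k, ‖v k (γ 0)‖ₑ ≤ 2⁻¹ ^ k * lineIntegral g γ l + ‖v k (γ t)‖ₑ := fun k => by
      have h1 : edist (v k (γ 0)) (v k (γ t)) ≤ 2⁻¹ ^ k * lineIntegral g γ l := by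
        refine ((hh k).edist_le hγ le_rfl ht.1 ht.2).trans ?_
        rw [lineIntegral, ← lintegral_const_mul' _ _ (by finiteness)]
        refine (lintegral_mono_set (Icc_subset_Icc_right ht.2)).trans (lintegral_mono fun s => ?_)
        calc h k (γ s) = 2⁻¹ ^ k * (2 ^ k * h k (γ s)) := by
              rw [← mul_assoc, ← mul_pow, ENNReal.inv_mul_cancel two_ne_zero ENNReal.ofNat_ne_top,
                one_pow, one_mul]
          _ ≤ _ := by
              gcongr
              exact (le_iSup (fun k => 2 ^ k * h k (γ s)) k).trans le_self_add
      calc ‖v k (γ 0)‖ₑ = edist (v k (γ 0)) 0 := (edist_zero_right _).symm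
        _ ≤ edist (v k (γ 0)) (v k (γ t)) + edist (v k (γ t)) 0 := edist_triangle _ _ _
        _ ≤ _ := by rw [edist_zero_right]; gcongr
    have hpow : Tendsto (fun k : ℕ => (2⁻¹ : ℝ≥0∞) ^ k) atTop (𝓝 0) :=
      ENNReal.tendsto_pow_atTop_nhds_zero_of_lt_one (by simp)
    have hlim := (ENNReal.Tendsto.mul_const hpow (Or.inr hfin)).add htZ
    rw [zero_mul, zero_add] at hlim
    exact tendsto_of_tendsto_of_tendsto_of_le_of_le tendsto_const_nhds hlim (fun _ => zero_le) hle
  obtain ⟨O, hO, hZO, hcap⟩ := exists_isOpen_sobolevCapacity_le hp hZ0 hgm hgp hex hε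
  refine ⟨O, hO, hcap, fun x hx => ?_⟩
  by_contra hcon
  exact hx (hZO hcon)

/-- Bounded integrable functions with a `p`-integrable upper gradient are quasicontinuous. -/
lemma exists_isOpen_continuousOn_of_bounded [ProperSpace X] [BorelSpace X]
    [IsLocallyFiniteMeasure μ] {C lam : ℝ} (hμ : IsDoubling μ) (hp : 0 < p) (hC : 0 < C)
    (hlam : 1 ≤ lam) (hPI : PoincareWith p μ C lam)
    {w : X → ℝ} {g : X → ℝ≥0∞} (hw : Integrable w μ) (hw1 : ∀ x, w x ∈ Icc (-1 : ℝ) 1)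
    (hg : IsUpperGradient (fun y => (w y : EReal)) g) (hgp : ∫⁻ x, g x ^ p ∂μ ≠ ⊤) {ε : ℝ≥0∞}
    (hε : ε ≠ 0) : ∃ G, IsOpen G ∧ sobolevCapacity p μ G ≤ ε ∧ ContinuousOn w Gᶜ := by
  set η : ℝ≥0∞ := min ε 1 / 4 with hη
  have hη0 : η ≠ 0 := ENNReal.div_ne_zero.2 ⟨by simp [hε], by simp⟩
  have hηt : η ≠ ⊤ := ENNReal.div_ne_top ((min_le_right _ _).trans_lt (by simp)).ne (by simp)
  have hηε : 4 * η ≤ ε := by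
    rw [hη, ENNReal.mul_div_cancel (by simp) (by simp)]; exact min_le_left _ _
  obtain ⟨e, he0, hesum⟩ := ENNReal.exists_pos_sum_of_countable' hη0 ℕ
  have hpow0 : ∀ k : ℕ, ((2 : ℝ≥0∞) ^ k) ^ p ≠ 0 := fun k => by simp [ENNReal.rpow_eq_zero_iff, hp.not_gt]
  have hpowt : ∀ k : ℕ, ((2 : ℝ≥0∞) ^ k) ^ p ≠ ⊤ := fun k => by finiteness
  -- The accuracy is chosen so that the set where `|w - L k| ≥ 2^{-k}` has capacity at most `e k`.
  choose L h hLc hh hb using fun k : ℕ => exists_continuous_approx hμ hp hC hlam hPI hw hw1 hg hgp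
    (ε := e k / (2 ^ k) ^ p) (ENNReal.div_ne_zero.2 ⟨(he0 k).ne', hpowt k⟩)
  have hb' : ∀ k, (2 ^ k) ^ p * (∫⁻ x, ‖w x - L k x‖ₑ ^ p ∂μ + ∫⁻ x, h k x ^ p ∂μ) ≤ e k :=
    fun k => by
      rw [mul_comm, ← ENNReal.le_div_iff_mul_le (Or.inl (hpow0 k)) (Or.inl (hpowt k))]
      exact hb k
  have hvm : ∀ k, AEMeasurable (fun x => w x - L k x) μ := fun k =>
    hw.aemeasurable.sub (hLc k).measurable.aemeasurable
  obtain ⟨O, hO, hOcap, hOt⟩ := exists_isOpen_tendsto hp hvm hh (hesum.trans hηt.lt_top).ne hb'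
    (ε := 2 * η) (mul_ne_zero two_ne_zero hη0)
  set A : ℕ → Set X := fun k => {x | 1 ≤ ((2 ^ k : ℝ≥0) : ℝ≥0∞) * ‖w x - L k x‖ₑ} with hA
  have hAcap : ∀ k, sobolevCapacity p μ (A k) ≤ e k := fun k =>
    (sobolevCapacity_superlevel_le hp (hvm k) (hh k) (by positivity)).trans
      (by push_cast; exact hb' k)
  have hA' : ∀ k, ∀ x ∉ A k, dist (w x) (L k x) ≤ 1 / 2 ^ k := fun k x hx => by
    have h1 : ((2 ^ k : ℝ≥0) : ℝ≥0∞) * ‖w x - L k x‖ₑ < 1 := not_le.1 hx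
    rw [← edist_eq_enorm_sub, edist_nndist, ← ENNReal.coe_mul, ← ENNReal.coe_one,
      ENNReal.coe_lt_coe, ← NNReal.coe_lt_coe] at h1
    push_cast at h1
    rw [le_div_iff₀ (by positivity), mul_comm]
    exact h1.le
  -- The sets `A k` need not be open because `w` is not continuous, whereas consecutive approximants
  -- give open sets. The form `4 / 2 / 2 ^ k` matches the geometric criterion with uniform error `4
  -- / 2 ^ k`.
  set D : ℕ → Set X := fun k => {x | 4 / 2 / 2 ^ k < dist (L k x) (L (k + 1) x)} with hD
  have hDo : ∀ k, IsOpen (D k) := fun k =>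
    isOpen_lt continuous_const ((hLc k).dist (hLc (k + 1)))
  have hDA : ∀ k, D k ⊆ A k ∪ A (k + 1) := fun k x hx => by
    by_contra hcon
    rw [mem_union, not_or] at hcon
    have h1 := hA' k x hcon.1
    have h2 := hA' (k + 1) x hcon.2
    have h3 : (1 : ℝ) / 2 ^ (k + 1) ≤ 1 / 2 ^ k := by
      gcongr
      · norm_num
      · omega
    have h4 : (4 : ℝ) / 2 / 2 ^ k < dist (L k x) (L (k + 1) x) := hx
    have h5 := dist_triangle_left (L k x) (L (k + 1) x) (w x)
    have h6 : (4 : ℝ) / 2 / 2 ^ k = 1 / 2 ^ k + 1 / 2 ^ k := by ring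
    linarith
  have hDcap : sobolevCapacity p μ (⋃ k, D k) ≤ 2 * η := by
    calc _ ≤ ∑' k, (e k + e (k + 1)) := (sobolevCapacity_iUnion_le hp D).trans
          (ENNReal.tsum_le_tsum fun k => (sobolevCapacity_mono (hDA k)).trans
            ((sobolevCapacity_union_le hp _ _).trans (add_le_add (hAcap k) (hAcap (k + 1)))))
      _ = ∑' k, e k + ∑' k, e (k + 1) := ENNReal.tsum_add
      _ ≤ η + η := add_le_add hesum.le
          ((ENNReal.tsum_comp_le_tsum_of_injective (add_left_injective 1) e).trans hesum.le)
      _ = 2 * η := (two_mul η).symm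
  refine ⟨(⋃ k, D k) ∪ O, (isOpen_iUnion hDo).union hO, ?_, ?_⟩
  · calc _ ≤ 2 * η + 2 * η := (sobolevCapacity_union_le hp _ _).trans (add_le_add hDcap hOcap)
      _ = 4 * η := by ring
      _ ≤ ε := hηε
  · have hunif : TendstoUniformlyOn L w atTop ((⋃ k, D k) ∪ O)ᶜ := by
      have hbound : ∀ k, ∀ x ∈ ((⋃ k, D k) ∪ O)ᶜ, dist (L k x) (w x) ≤ 4 / 2 ^ k := by
        intro k x hx
        rw [mem_compl_iff, mem_union, not_or] at hx
        refine dist_le_of_le_geometric_two_of_tendsto (f := fun k => L k x) (fun k => ?_) ?_ k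
        · by_contra hcon
          exact hx.1 (mem_iUnion.2 ⟨k, not_le.1 hcon⟩)
        · rw [tendsto_iff_edist_tendsto_0]
          simpa only [edist_comm, edist_eq_enorm_sub] using hOt x hx.2
      rw [Metric.tendstoUniformlyOn_iff]
      intro δ hδ
      have hlim : Tendsto (fun k : ℕ => (4 : ℝ) / 2 ^ k) atTop (𝓝 0) := by
        have := (tendsto_pow_atTop_nhds_zero_of_lt_one (r := (2 : ℝ)⁻¹) (by norm_num)
          (by norm_num)).const_mul 4
        simpa [div_eq_mul_inv] using this
      filter_upwards [hlim.eventually (gt_mem_nhds hδ)] with k hk x hx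
      rw [dist_comm]
      exact (hbound k x hx).trans_lt hk
    exact hunif.continuousOn (Frequently.of_forall fun k => (hLc k).continuousOn)

end Quasicontinuity

/-! ### Reduction of Dirichlet functions to the bounded integrable case. -/

section DirichletQuasicontinuity

variable {X : Type*} [MetricSpace X]

/-- Half the arctangent, with value `0` at `±∞`. -/
noncomputable def halfArctan (a : EReal) : ℝ := Real.arctan a.toReal / 2

lemma halfArctan_mem (a : EReal) : halfArctan a ∈ Icc (-1 : ℝ) 1 := by
  have h1 := Real.neg_pi_div_two_lt_arctan a.toReal
  have h2 := Real.arctan_lt_pi_div_two a.toReal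
  have h3 := Real.pi_lt_four
  constructor <;> rw [halfArctan] <;> linarith

lemma lipschitzWith_arctan : LipschitzWith 1 Real.arctan := by
  refine lipschitzWith_of_nnnorm_deriv_le Real.differentiable_arctan fun x => ?_
  rw [Real.deriv_arctan, ← NNReal.coe_le_coe, coe_nnnorm, Real.norm_of_nonneg (by positivity),
    NNReal.coe_one, div_le_one (by positivity)]
  nlinarith [sq_nonneg x]

lemma edist_halfArctan_le (a b : EReal) : edist (halfArctan a) (halfArctan b) ≤ (a - b).abs := by
  induction a with
  | bot => induction b <;> simp
  | top => induction b <;> simp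
  | coe a =>
    induction b with
    | bot => simp
    | top => simp
    | coe b =>
      have h1 := lipschitzWith_arctan.dist_le_mul a b
      rw [abs_coe_sub_coe, edist_dist, edist_dist, halfArctan, halfArctan, EReal.toReal_coe,
        EReal.toReal_coe]
      refine ENNReal.ofReal_le_ofReal ?_
      rw [Real.dist_eq, ← sub_div, abs_div, abs_two, ← Real.dist_eq]
      rw [NNReal.coe_one, one_mul] at h1
      linarith [dist_nonneg (x := Real.arctan a) (y := Real.arctan b)]

lemma measurable_halfArctan : Measurable halfArctan :=
  (Real.measurable_arctan.comp measurable_ereal_toReal).div_const 2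

/-- Continuity of `u` is recovered from that of `halfArctan ∘ u` wherever `u` is finite. -/
lemma coe_tan_two_mul_halfArctan {a : EReal} (h1 : a ≠ ⊤) (h2 : a ≠ ⊥) :
    ((Real.tan (2 * halfArctan a) : ℝ) : EReal) = a := by
  rw [halfArctan, mul_div_cancel₀ _ two_ne_zero, Real.tan_arctan, EReal.coe_toReal h1 h2]

lemma continuousAt_tan_two_mul_halfArctan (a : EReal) :
    ContinuousAt (fun t : ℝ => ((Real.tan (2 * t) : ℝ) : EReal)) (halfArctan a) := by
  refine continuous_coe_real_ereal.continuousAt.comp ?_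
  refine ContinuousAt.comp (g := Real.tan) (f := fun t : ℝ => 2 * t) ?_ (by fun_prop)
  refine Real.continuousAt_tan.2 ?_
  rw [halfArctan, mul_div_cancel₀ _ two_ne_zero]
  exact (Real.cos_arctan_pos _).ne'

/-- The cutoff function that is `1` on `B(z, n)` and `0` off `B(z, n + 1)`. -/
noncomputable def cutoff (z : X) (n : ℕ) (x : X) : ℝ := max 0 (min 1 (n + 1 - dist x z))

lemma lipschitzWith_cutoff (z : X) (n : ℕ) : LipschitzWith 1 (cutoff z n) := by
  have h : LipschitzWith 1 (fun x => (n : ℝ) + 1 - dist x z) :=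
    LipschitzWith.of_dist_le_mul fun x y => by
      rw [NNReal.coe_one, one_mul, Real.dist_eq, sub_sub_sub_cancel_left, abs_sub_comm]
      exact abs_dist_sub_le x y z
  exact (h.const_min 1).const_max 0

lemma cutoff_mem (z : X) (n : ℕ) (x : X) : cutoff z n x ∈ Icc (0 : ℝ) 1 :=
  ⟨le_max_left _ _, max_le zero_le_one (min_le_left _ _)⟩

lemma cutoff_eq_one {z : X} {n : ℕ} {x : X} (h : dist x z ≤ n) : cutoff z n x = 1 := by
  rw [cutoff, min_eq_left (by linarith), max_eq_right zero_le_one]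

lemma cutoff_eq_zero {z : X} {n : ℕ} {x : X} (h : x ∉ Metric.ball z (n + 1)) :
    cutoff z n x = 0 := by
  rw [Metric.mem_ball, not_lt] at h
  exact max_eq_left ((min_le_right _ _).trans (by linarith))

lemma edist_mul_mul_le {a b c d : ℝ} (hb : |b| ≤ 1) (hc : |c| ≤ 1) :
    edist (a * b) (c * d) ≤ edist a c + edist b d := by
  rw [edist_dist, edist_dist, edist_dist, ← ENNReal.ofReal_add dist_nonneg dist_nonneg]
  refine ENNReal.ofReal_le_ofReal ?_
  rw [Real.dist_eq, Real.dist_eq, Real.dist_eq]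
  calc |a * b - c * d| = |(a - c) * b + c * (b - d)| := by ring_nf
    _ ≤ |(a - c) * b| + |c * (b - d)| := abs_add_le _ _
    _ ≤ |a - c| + |b - d| := by
        rw [abs_mul, abs_mul]
        exact add_le_add (mul_le_of_le_one_right (abs_nonneg _) hb)
          (mul_le_of_le_one_left (abs_nonneg _) hc)

variable [MeasurableSpace X] {μ : Measure X} {p : ℝ}

lemma isUpperGradient_mul [BorelSpace X] {u v : X → ℝ} {g h : X → ℝ≥0∞}
    (hu : IsUpperGradient (fun x => (u x : EReal)) g)
    (hv : IsUpperGradient (fun x => (v x : EReal)) h) (hu1 : ∀ x, |u x| ≤ 1)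
    (hv1 : ∀ x, |v x| ≤ 1) :
    IsUpperGradient (fun x => ((u x * v x : ℝ) : EReal)) (fun x => g x + h x) := by
  refine isUpperGradient_coe_iff.2 ⟨hu.1.add hv.1, fun l γ hl hγ => ?_⟩
  rw [lineIntegral, lintegral_add_left' (f := fun t => g (γ t))
    (hu.1.comp_aemeasurable (aemeasurable_comp_curve hγ))]
  exact (edist_mul_mul_le (hv1 _) (hu1 _)).trans
    (add_le_add ((isUpperGradient_coe_iff.1 hu).2 l γ hl hγ)
      ((isUpperGradient_coe_iff.1 hv).2 l γ hl hγ))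

lemma exists_isOpen_continuousOn_ball [ProperSpace X] [BorelSpace X]
    [IsLocallyFiniteMeasure μ] {C lam : ℝ} (hμ : IsDoubling μ) (hp : 0 < p) (hC : 0 < C)
    (hlam : 1 ≤ lam) (hPI : PoincareWith p μ C lam)
    {u : X → EReal} {g : X → ℝ≥0∞} (hu : AEMeasurable u μ) (hg : IsUpperGradient u g)
    (hgp : ∫⁻ x, g x ^ p ∂μ ≠ ⊤) (z : X) (n : ℕ) {ε : ℝ≥0∞} (hε : ε ≠ 0) :
    ∃ G, IsOpen G ∧ sobolevCapacity p μ G ≤ ε ∧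
      ContinuousOn (fun x => halfArctan (u x)) (Metric.ball z n ∩ Gᶜ) := by
  set B := Metric.ball z ((n : ℝ) + 1) with hB
  have hBm : MeasurableSet B := Metric.isOpen_ball.measurableSet
  have hBfin : μ B ≠ ⊤ := (hμ.1 z _ (by positivity)).2.ne
  set w : X → ℝ := fun x => halfArctan (u x) * cutoff z n x with hw
  have habs : ∀ x, |halfArctan (u x)| ≤ 1 := fun x => abs_le.2 (halfArctan_mem (u x))
  have habs' : ∀ x, |cutoff z n x| ≤ 1 := fun x => by
    rw [abs_of_nonneg (cutoff_mem z n x).1]; exact (cutoff_mem z n x).2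
  have hw1 : ∀ x, |w x| ≤ 1 := fun x => by
    rw [hw, abs_mul]; exact mul_le_one₀ (habs x) (abs_nonneg _) (habs' x)
  have hw0 : ∀ x ∉ B, w x = 0 := fun x hx => by simp [hw, cutoff_eq_zero hx]
  have hwm : AEMeasurable w μ := (measurable_halfArctan.comp_aemeasurable hu).mul
    (lipschitzWith_cutoff z n).continuous.measurable.aemeasurable
  have hint : Integrable w μ := by
    refine Integrable.mono' (g := B.indicator fun _ => (1 : ℝ))
      ((integrable_indicator_iff hBm).2 (integrableOn_const hBfin)) hwm.aestronglyMeasurable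
      (Eventually.of_forall fun x => ?_)
    by_cases hx : x ∈ B
    · rw [indicator_of_mem hx]; exact hw1 x
    · simp [hw0 x hx, hx]
  have hug1 := hg.comp (φ := halfArctan) (K := 1)
    (fun a b => by simpa using edist_halfArctan_le a b)
  -- Restricting the gradient to the bounded set `B` makes the constant contributed by the cutoff
  -- `p`-integrable.
  have hug := isUpperGradient_indicator_of_eq_zero (isUpperGradient_mul hug1
    (isUpperGradient_of_lipschitzWith (lipschitzWith_cutoff z n)) habs habs') Metric.isOpen_ball hw0
  have hfin : ∫⁻ x, B.indicator (fun x => (1 : ℝ≥0) * g x + (1 : ℝ≥0)) x ^ p ∂μ ≠ ⊤ := by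
    have h1 : ∫⁻ x, B.indicator (fun x => (1 : ℝ≥0) * g x + (1 : ℝ≥0)) x ^ p ∂μ ≤
        ∫⁻ x, 2 ^ p * (g x ^ p + B.indicator 1 x) ∂μ := by
      refine lintegral_mono fun x => ?_
      by_cases hx : x ∈ B
      · simpa [hx] using add_rpow_le_two_rpow_mul hp (g x) 1
      · simp [hx, hp]
    refine ne_top_of_le_ne_top ?_ h1
    rw [lintegral_const_mul' _ _ (by finiteness), lintegral_add_left (hg.1.pow_const p),
      lintegral_indicator_one hBm]
    exact ENNReal.mul_ne_top (by finiteness) (ENNReal.add_ne_top.2 ⟨hgp, hBfin⟩)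
  obtain ⟨G, hG, hcap, hcont⟩ := exists_isOpen_continuousOn_of_bounded hμ hp hC hlam hPI hint
    (fun x => abs_le.1 (hw1 x)) hug hfin hε
  refine ⟨G, hG, hcap, (hcont.mono inter_subset_right).congr fun x hx => ?_⟩
  have : dist x z ≤ n := (Metric.mem_ball.1 hx.1).le
  simp [hw, cutoff_eq_one this]

/-- Dirichlet functions that are finite almost everywhere are quasicontinuous. -/
theorem exists_isOpen_continuousOn [ProperSpace X] [BorelSpace X]
    [IsLocallyFiniteMeasure μ] {C lam : ℝ} (hμ : IsDoubling μ) (hp : 0 < p) (hC : 0 < C)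
    (hlam : 1 ≤ lam) (hPI : PoincareWith p μ C lam)
    {u : X → EReal} {g : X → ℝ≥0∞} (hu : AEMeasurable u μ) (hg : IsUpperGradient u g)
    (hgp : ∫⁻ x, g x ^ p ∂μ ≠ ⊤) (hfin : μ {x | (u x).abs = ⊤} = 0) {ε : ℝ≥0∞} (hε : ε ≠ 0) :
    ∃ G, IsOpen G ∧ sobolevCapacity p μ G ≤ ε ∧ ContinuousOn u Gᶜ ∧
      ∀ x ∉ G, u x ≠ ⊤ ∧ u x ≠ ⊥ := by
  have hε2 : ε / 2 ≠ 0 := ENNReal.div_ne_zero.2 ⟨hε, by simp⟩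
  obtain ⟨O, hO, hAO, hOcap⟩ := exists_isOpen_sobolevCapacity_le hp hfin hg.1 hgp.lt_top
    (fun l γ hl hγ h0 =>
      lineIntegral_eq_top_of_abs_eq_top hg hl hγ (left_mem_Icc.2 hl.le) h0) hε2
  obtain ⟨e, he0, hesum⟩ := ENNReal.exists_pos_sum_of_countable' hε2 ℕ
  rcases isEmpty_or_nonempty X with hX | ⟨⟨z⟩⟩
  · exact ⟨O, hO, hOcap.trans ENNReal.half_le_self, by
      rw [Set.eq_empty_of_isEmpty Oᶜ]; exact continuousOn_empty _, fun x => isEmptyElim x⟩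
  choose G hG hcap hcont using fun n : ℕ =>
    exists_isOpen_continuousOn_ball hμ hp hC hlam hPI hu hg hgp z n (he0 n).ne'
  have hreal : ∀ x ∉ (⋃ n, G n) ∪ O, u x ≠ ⊤ ∧ u x ≠ ⊥ := fun x hx => by
    have hx' : (u x).abs ≠ ⊤ := fun h => hx (Or.inr (hAO h))
    constructor <;> intro h <;> simp [h] at hx'
  refine ⟨(⋃ n, G n) ∪ O, (isOpen_iUnion hG).union hO, ?_, fun x hx => ?_, hreal⟩
  · calc _ ≤ ∑' n, e n + ε / 2 := (sobolevCapacity_union_le hp _ _).trans (add_le_add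
          ((sobolevCapacity_iUnion_le hp G).trans (ENNReal.tsum_le_tsum hcap)) hOcap)
      _ ≤ ε / 2 + ε / 2 := by gcongr
      _ = ε := ENNReal.add_halves ε
  · obtain ⟨n, hn⟩ := exists_nat_gt (dist x z)
    have hball : Metric.ball z n ∈ 𝓝[((⋃ n, G n) ∪ O)ᶜ] x :=
      mem_nhdsWithin_of_mem_nhds (Metric.isOpen_ball.mem_nhds hn)
    have hsub : ((⋃ n, G n) ∪ O)ᶜ ⊆ (G n)ᶜ :=
      compl_subset_compl.2 ((subset_iUnion G n).trans subset_union_left)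
    have h1 : ContinuousWithinAt (fun x => halfArctan (u x)) ((⋃ n, G n) ∪ O)ᶜ x := by
      have := hcont n x ⟨hn, hsub hx⟩
      refine this.mono_of_mem_nhdsWithin ?_
      exact inter_mem hball (mem_of_superset self_mem_nhdsWithin hsub)
    have h2 := (continuousAt_tan_two_mul_halfArctan (u x)).comp_continuousWithinAt
      (f := fun x => halfArctan (u x)) h1
    refine h2.congr (fun y hy => ?_) ?_
    · exact (coe_tan_two_mul_halfArctan (hreal y hy).1 (hreal y hy).2).symm
    · exact (coe_tan_two_mul_halfArctan (hreal x hx).1 (hreal x hx).2).symm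

end DirichletQuasicontinuity

/-! ### Comparing the Sobolev capacity with the capacity relative to `Ω`. -/

section SmallCapacity

variable {X : Type*} [MetricSpace X] [MeasurableSpace X] {μ : Measure X} {p : ℝ} {Ω : Set X}

lemma IsUpperGradient.restrict {u : X → EReal} {g : X → ℝ≥0∞} (h : IsUpperGradient u g)
    (Ω : Set X) : IsUpperGradient (fun x : Ω => u x) (fun x : Ω => g x) :=
  ⟨h.1.comp measurable_subtype_coe, fun l γ hl hγ => h.2 l (fun t => (γ t : X)) hl hγ⟩

/-- Openness of `V` turns the pointwise bound on `Ω ∩ V` into the liminf condition at boundary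
points of `E`. -/
lemma smallCapacity_le (hp : 0 < p) {E : Set X} {w : Ω → ℝ} {g : Ω → ℝ≥0∞}
    (hw : AEMeasurable w (μ.comap ((↑) : Ω → X)))
    (h : IsUpperGradient (fun x => (w x : EReal)) g) {V : Set X} (hV : IsOpen V) (hEV : E ⊆ V)
    (hwV : ∀ x : Ω, (x : X) ∈ V → 1 ≤ w x) :
    smallCapacity p μ Ω E ≤ ∫⁻ x, ‖w x‖ₑ ^ p ∂(μ.comap ((↑) : Ω → X)) +
      ∫⁻ x, g x ^ p ∂(μ.comap ((↑) : Ω → X)) := by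
  rcases eq_or_ne (∫⁻ x, ‖w x‖ₑ ^ p ∂(μ.comap ((↑) : Ω → X)) +
    ∫⁻ x, g x ^ p ∂(μ.comap ((↑) : Ω → X))) ⊤ with htop | htop
  · rw [htop]; exact le_top
  refine (iInf₂_le (fun x => (w x : EReal)) ⟨memNewtonian_coe hp hw h htop.lt_top, ?_, ?_⟩).trans
    (newtonianSeminorm_rpow_le hp h)
  · exact fun x hx => EReal.coe_le_coe_iff.2 (hwV x (hEV hx))
  · intro x hx
    refine le_liminf_of_le (by isBoundedDefault) ?_
    rw [eventually_comap]
    filter_upwards [hV.mem_nhds (hEV hx.1)] with y hy z hz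
    exact EReal.coe_le_coe_iff.2 (hwV z (hz ▸ hy))

lemma one_le_two_mul_abs {a : EReal} (h : ((1 / 2 : ℝ) : EReal) < a) :
    1 ≤ ((2 : ℝ≥0) : ℝ≥0∞) * a.abs := by
  induction a with
  | bot => simp at h
  | top => simp [ENNReal.mul_top]
  | coe a =>
    have h' : 1 / 2 < a := EReal.coe_lt_coe_iff.1 h
    rw [EReal.abs_def, ENNReal.coe_ofNat, ← ENNReal.ofReal_ofNat, ← ENNReal.ofReal_mul zero_le_two,
      ← ENNReal.ofReal_one]
    refine ENNReal.ofReal_le_ofReal ?_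
    rw [abs_of_pos (by linarith)]
    linarith

/-- A subset of the boundary of zero capacity together with an open set of small capacity is
contained in an open set of small capacity. -/
lemma exists_isOpen_smallCapacity_lt [BorelSpace X] (hp : 0 < p) (hΩ : IsOpen Ω) {G E : Set X}
    (hG : IsOpen G) {a b : ℝ≥0∞} (hGa : sobolevCapacity p μ G < a) (hE : E ⊆ frontier Ω)
    (hEb : smallCapacity p μ Ω E < b) : ∃ V, IsOpen V ∧ G ⊆ V ∧ E ⊆ V ∧
      ∀ F ⊆ V, smallCapacity p μ Ω F ≤ a + 2 ^ p * b := by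
  obtain ⟨v, g, hv, hv1, hvG, hg, hlt⟩ := exists_of_sobolevCapacity_lt hp hGa
  simp only [smallCapacity, iInf_lt_iff] at hEb
  obtain ⟨u, ⟨hu, -, huE⟩, hub⟩ := hEb
  obtain ⟨hum, h, hh, hhb⟩ := hu.exists_truncAbs hp hub two_ne_zero
  -- Points outside `Ω` satisfy the condition vacuously, so the liminf bound in `Ω` makes `W` a full
  -- neighbourhood in `X` of each point of `E`.
  set W := interior {y : X | ∀ hy : y ∈ Ω, ((1 / 2 : ℝ) : EReal) < u ⟨y, hy⟩} with hW
  have hEW : E ⊆ W := fun x hx => by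
    have h1 := huE x ⟨hx, hE hx⟩
    have h2 : ∀ᶠ y in comap ((↑) : Ω → X) (𝓝 x), ((1 / 2 : ℝ) : EReal) < u y := by
      refine eventually_lt_of_lt_liminf (lt_of_lt_of_le ?_ h1)
      exact_mod_cast (by norm_num : (1 / 2 : ℝ) < 1)
    rw [eventually_comap] at h2
    rw [hW, mem_interior_iff_mem_nhds]
    filter_upwards [h2] with y hy hyΩ
    exact hy ⟨y, hyΩ⟩ rfl
  have hΩm := hΩ.measurableSet
  have hmp := measurePreserving_subtype_coe (μa := μ) hΩm
  have hvr : AEMeasurable (fun x : Ω => v x) (μ.comap ((↑) : Ω → X)) :=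
    (hv.restrict (s := Ω)).comp_quasiMeasurePreserving hmp.quasiMeasurePreserving
  -- The maximum of two functions, indexed by `Bool`: the restriction of `v` serves `G`, the doubled
  -- truncation of `u` serves `W`.
  obtain ⟨h1, h2, h3⟩ := exists_iSup_bound hp (μ := μ.comap ((↑) : Ω → X))
    (v := fun i : Bool => cond i (fun x : Ω => v x) (fun x => truncAbs 2 (u x)))
    (g := fun i : Bool => cond i (fun x : Ω => g x) h)
    (by rintro (_ | _); exacts [hum, hvr])
    (by rintro (_ | _) x; exacts [truncAbs_mem 2 (u x), hv1 x])
    (by rintro (_ | _); exacts [hh, hg.restrict Ω])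
  refine ⟨G ∪ W, hG.union isOpen_interior, subset_union_left, hEW.trans subset_union_right,
    fun F hF => (smallCapacity_le hp h1 h2 (hG.union isOpen_interior) hF ?_).trans (h3.trans ?_)⟩
  · intro x hx
    have hbdd : BddAbove (range fun i : Bool =>
        (cond i (fun x : Ω => v x) (fun x => truncAbs 2 (u x)) : Ω → ℝ) x) := (finite_range _).bddAbove
    rcases hx with hx | hx
    · exact (hvG x hx).ge.trans (le_ciSup hbdd true)
    · exact (truncAbs_eq_one (one_le_two_mul_abs (interior_subset hx x.2))).ge.trans
        (le_ciSup hbdd false)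
  · rw [tsum_bool, add_comm]
    simp only [cond_true, cond_false]
    refine add_le_add (le_trans ?_ hlt.le) (by simpa using hhb.le)
    rw [lintegral_subtype_comap hΩm (fun x => ‖v x‖ₑ ^ p), lintegral_subtype_comap hΩm (fun x => g x ^ p)]
    exact add_le_add (setLIntegral_le_lintegral _ _) (setLIntegral_le_lintegral _ _)

end SmallCapacity

end MetricPotential

/-! ### The proposition. -/

theorem proposition6p3 {X : Type*} [MetricSpace X] [CompleteSpace X]
    [MeasurableSpace X] [BorelSpace X] (μ : Measure X) (p : ℝ) (hp : 1 < p)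
    (hμ : MetricPotential.IsDoubling μ) (hPI : MetricPotential.SupportsPoincare p μ)
    (Ω : Set X) (hΩ : IsOpen Ω) (hΩne : Ω.Nonempty)
    (hcap : 0 < MetricPotential.sobolevCapacity p μ Ωᶜ)
    (f : closure Ω → EReal)
    (hf : MetricPotential.MemDirichletZero p μ Ω
      (fun x : Ω => f ⟨(x : X), subset_closure x.2⟩))
    (hf₀ : MetricPotential.smallCapacity p μ Ω
      {x : X | ∃ hx : x ∈ frontier Ω, f ⟨x, frontier_subset_closure hx⟩ ≠ 0} = 0) :
    MetricPotential.IsSmallQuasicontinuous p μ Ω f := by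
  have hp0 : 0 < p := one_pos.trans hp
  have := hμ.properSpace
  have := hμ.isLocallyFiniteMeasure
  obtain ⟨C, lam, hC, hlam, hPI⟩ := hPI
  obtain ⟨u, ⟨hu, g, hg, hgp⟩, hu0, hfu⟩ := hf
  have hfin := MetricPotential.measure_abs_eq_top hμ hp0 hlam hPI hu hg hgp.ne hcap hu0
  intro ε hε
  set η : ℝ≥0∞ := min ε 1 / 4 with hη
  have hη0 : η ≠ 0 := ENNReal.div_ne_zero.2 ⟨by simp [hε.ne'], by simp⟩
  have hηt : η ≠ ⊤ := ENNReal.div_ne_top ((min_le_right _ _).trans_lt (by simp)).ne (by simp)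
  have hηε : 4 * η ≤ ε := by
    rw [hη, ENNReal.mul_div_cancel (by simp) (by simp)]; exact min_le_left _ _
  obtain ⟨G, hG, hGcap, hcont, hreal⟩ :=
    MetricPotential.exists_isOpen_continuousOn hμ hp0 hC hlam hPI hu hg hgp.ne hfin hη0
  set E := {x : X | ∃ hx : x ∈ frontier Ω, f ⟨x, frontier_subset_closure hx⟩ ≠ 0} with hE
  have hc : (2 : ℝ≥0∞) ^ p ≠ 0 ∧ (2 : ℝ≥0∞) ^ p ≠ ⊤ :=
    ⟨by simp [ENNReal.rpow_eq_zero_iff], by finiteness⟩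
  -- With these choices the total is `2 * η + 2 ^ p * (η / 2 ^ p) = 3 * η`, strictly below `4 * η ≤
  -- ε` since `η` is finite and positive.
  obtain ⟨V, hV, hGV, hEV, hVcap⟩ := MetricPotential.exists_isOpen_smallCapacity_lt hp0 hΩ hG
    (a := 2 * η) (b := η / 2 ^ p) (E := E)
    (hGcap.trans_lt (by rw [two_mul]; exact ENNReal.lt_add_right hηt hη0))
    (fun x hx => hx.1) (by rw [hf₀]; exact ENNReal.div_pos hη0 hc.2)
  have hfu' : ∀ x : closure Ω, (x : X) ∉ V → f x = u x := by
    rintro ⟨x, hx⟩ hxV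
    by_cases hxΩ : x ∈ Ω
    · exact hfu ⟨x, hxΩ⟩
    · rw [hu0 x hxΩ]
      by_contra hne
      exact hxV (hEV ⟨by rw [hΩ.frontier_eq]; exact ⟨hx, hxΩ⟩, hne⟩)
  refine ⟨(↑) ⁻¹' V, hV.preimage continuous_subtype_val, ?_, ?_, ?_⟩
  · refine (hVcap _ (image_preimage_subset _ _)).trans_lt ?_
    rw [ENNReal.mul_div_cancel hc.1 hc.2]
    refine lt_of_lt_of_le ?_ hηε
    rw [show (4 : ℝ≥0∞) * η = 2 * η + η + η by ring]
    exact ENNReal.lt_add_right (by finiteness) hη0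
  · have h1 : ContinuousOn (fun x : closure Ω => u x) ((↑) ⁻¹' V)ᶜ :=
      hcont.comp continuous_subtype_val.continuousOn fun x hx hxG => hx (hGV hxG)
    exact h1.congr fun x hx => hfu' x hx
  · intro x hx
    rw [hfu' x hx]
    exact hreal x fun hxG => hx (hGV hxG)
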